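/- There is a universal constant $\alpha>0$ such that the following holds. Let $G=(V,E)$ be a finite undirected graph without self-loops (parallel edges are allowed) that has at least three vertices, is 2-connected, and has maximum degree $\Delta$, where parallel edges are counted separately in the degree. Then there is a partition $(A,B)$ of $V$ such that the induced subgraph $G[A]$ is connected, the induced subgraph $G[B]$ is 2-connected, and $$\min\bigl(\mathrm{tw}(G[A]),\,\mathrm{tw}(G[B])\bigr)\;\ge\;\left\lfloor \frac{\alpha\,\mathrm{tw}(G)}{\Delta^2}\right\rfloor .$$ Here $\mathrm{tw}$ denotes treewidth (the least value, over all tree decompositions, of the largest bag size minus one), connected graphs are nonempty, and a graph is called 2-connected if it is connected, has at least two vertices, and has no vertex $u$ such that $G-u$ is disconnected; in particular, a pair of vertices joined by one or more edges is 2-connected. -/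

import Mathlib

universe u v

namespace Graph

/-- A multigraph is connected if it is nonempty and any two of its vertices are joined by a path
(parallel edges play no role here, so this is connectedness of the underlying simple graph). -/
def IsConnected {α : Type u} {β : Type v} (G : Graph α β) : Prop :=
  G.toSimpleGraph.Connected

/-- A multigraph is 2-connected if it is connected, has at least two vertices, and contains no
1-separator, i.e. no vertex `x` such that `G - x` is disconnected. -/
structure IsTwoConnected {α : Type u} {β : Type v} (G : Graph α β) : Prop where
  connected : G.IsConnected
  two_vertices : G.vertexSet.Nontrivial
  no_separator : ∀ x ∈ G.vertexSet, (G.deleteVerts {x}).IsConnected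

/-- The degree of a vertex of a loopless multigraph: the number of incident edges, parallel edges
being counted separately. -/
noncomputable def deg {α : Type u} {β : Type v} (G : Graph α β) (x : α) : ℕ :=
  (G.incidenceSet x).ncard

/-- The maximum degree of a finite multigraph. -/
noncomputable def maxDeg {α : Type u} {β : Type v} (G : Graph α β) : ℕ :=
  sSup (G.deg '' G.vertexSet)

/-- A tree decomposition of `G` over a tree with node set `ι`. -/
structure TreeDecomposition {α : Type u} {β : Type v} (G : Graph α β) (ι : Type) where
  /-- The decomposition tree. -/
  tree : SimpleGraph ι
  isTree : tree.IsTree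
  /-- The bag of a node. -/
  bag : ι → Finset α
  bag_subset : ∀ t, (bag t : Set α) ⊆ G.vertexSet
  vertex_mem : ∀ x ∈ G.vertexSet, ∃ t, x ∈ bag t
  edge_mem : ∀ e x y, G.IsLink e x y → ∃ t, x ∈ bag t ∧ y ∈ bag t
  connected : ∀ x ∈ G.vertexSet, (tree.induce {t | x ∈ bag t}).Connected

/-- The width of a tree decomposition over a finite tree: the largest size of a bag, minus one.
(Truncated subtraction matters only if all bags are empty, i.e. if the graph has no vertex.) -/
def TreeDecomposition.width {α : Type u} {β : Type v} {G : Graph α β} {ι : Type} [Fintype ι]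
    (D : G.TreeDecomposition ι) : ℕ :=
  (Finset.univ.sup fun t => (D.bag t).card) - 1

/-- The treewidth of a finite multigraph: the least width of a tree decomposition. -/
noncomputable def treewidth {α : Type u} {β : Type v} (G : Graph α β) : ℕ :=
  sInf {k | ∃ (n : ℕ) (D : G.TreeDecomposition (Fin n)), D.width = k}

end Graph

/-! ### Rooted tree decompositions of vertex sets -/

namespace TreewidthSplit

open Finset
open scoped Classical

variable {α : Type u}

/-! Fix `t`, the claimed lower bound, and call a vertex set small if it induces treewidth below `t`.
The heart is `small_of_forall_disjoint`: if one of any two disjoint sets is always small, the whole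
graph has treewidth `O(Δ t)`. Hence large treewidth yields two disjoint sets that are not small.
Shrink both to minimal ones. A minimal non-small set is connected, since decompositions of
nonadjacent parts combine, and 2-connected, since decompositions also combine at a cut vertex once
re-rooted there. `TwoConn.exists_partition` then grows the pair to a partition of `V`, adding single
vertices to the connected side and ears to the 2-connected side; non-smallness survives enlargement.

For the heart, let `b` be least such that `V` has a decomposition with bags of size at most `b`.
Some set `W` of at most `b` vertices has a small complement (`Dec.small_or_exists_small_compl`).
Taking `V \ W` as one class and the vertices of `W` as singletons gives a partition into small
classes with at most `2bΔ` crossing ordered pairs. Among all deleted sets `Z` and partitions of `V \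
Z` into small classes, minimise `8Δ|Z|` plus the number of crossing pairs. By `exists_fewer_cross`,
deleting `36t` further vertices removes a fixed fraction of the crossing pairs unless there are
fewer than 48, so at the minimum only `O(Δ t)` remain, while `|Z| ≤ b/4`. Adding `Z` and one end of
each crossing pair to all bags gives `b ≤ t + b/4 + O(Δ t)`.

For `exists_fewer_cross`, the classes are broken by few deletions into pieces meeting few crossing
pairs (`Dec.exists_break`), and the pieces are gathered into fewer than 36 groups. Two groups `U`
carry a constant fraction of the pairs, and so does the complement of `U`. List the class fragments
inside `U` first, then those outside. At the first fragment where the initial union stops being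
small, the parts before, at and after it are all small; the new three-class partition swallows all
pairs inside `U` or all pairs outside it.

The bound obtained is linear in `Δ`; the square in the theorem is only a weakening. -/

/-- `Dec H b X C`: the subgraph of `H` on `X ∪ C` has a rooted tree decomposition with bags of
size at most `b`, whose root bag is `X`; the set `C` consists of the remaining vertices. -/
inductive Dec (H : SimpleGraph α) (b : ℕ) : Finset α → Finset α → Prop
  | nil (X : Finset α) : X.card ≤ b → Dec H b X ∅
  | union (X C₁ C₂ : Finset α) : Dec H b X C₁ → Dec H b X C₂ → Disjoint C₁ C₂ →
      (∀ x ∈ C₁, ∀ y ∈ C₂, ¬ H.Adj x y) → Dec H b X (C₁ ∪ C₂)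
  | step (X X' C : Finset α) : X.card ≤ b → Dec H b X' C → Disjoint X C →
      (∀ x ∈ (X' \ X) ∪ C, ∀ y ∈ X \ X', ¬ H.Adj x y) → Dec H b X ((X' \ X) ∪ C)

/-- `Small H b S`: the subgraph of `H` induced by `S` has treewidth less than `b` (or `S = ∅`). -/
def Small (H : SimpleGraph α) (b : ℕ) (S : Finset α) : Prop := Dec H b ∅ S

variable {H K : SimpleGraph α} {b : ℕ} {X C S T : Finset α}

lemma Dec.card_le (h : Dec H b X C) : X.card ≤ b := by
  induction h <;> assumption

lemma Dec.disjoint (h : Dec H b X C) : Disjoint X C := by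
  induction h with
  | nil X hX => simp
  | union X C₁ C₂ h₁ h₂ hd hn ih₁ ih₂ => exact disjoint_union_right.2 ⟨ih₁, ih₂⟩
  | step X X' C hX h hd hn ih => exact disjoint_union_right.2 ⟨disjoint_sdiff, hd⟩

lemma Dec.inter (h : Dec H b X C) (S : Finset α) : Dec H b (X ∩ S) (C ∩ S) := by
  induction h with
  | nil X hX =>
    rw [empty_inter]
    exact .nil _ ((card_le_card inter_subset_left).trans hX)
  | union X C₁ C₂ h₁ h₂ hd hn ih₁ ih₂ =>
    rw [union_inter_distrib_right]
    refine .union _ _ _ ih₁ ih₂ (hd.mono inter_subset_left inter_subset_left) ?_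
    intro x hx y hy
    exact hn x (mem_inter.1 hx).1 y (mem_inter.1 hy).1
  | step X X' C hX h hd hn ih =>
    have e : ((X' \ X) ∪ C) ∩ S = ((X' ∩ S) \ (X ∩ S)) ∪ (C ∩ S) := by
      ext x; simp only [mem_inter, mem_union, mem_sdiff]; tauto
    rw [e]
    refine .step _ _ _ ((card_le_card inter_subset_left).trans hX) ih
      (hd.mono inter_subset_left inter_subset_left) ?_
    intro x hx y hy
    refine hn x ?_ y ?_
    · simp only [mem_inter, mem_union, mem_sdiff] at hx ⊢
      tauto
    · simp only [mem_inter, mem_sdiff] at hy ⊢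
      tauto

lemma Dec.mono_right {b' : ℕ} (h : Dec H b X C) (hb : b ≤ b') : Dec H b' X C := by
  induction h with
  | nil X hX => exact .nil _ (hX.trans hb)
  | union X C₁ C₂ h₁ h₂ hd hn ih₁ ih₂ => exact .union _ _ _ ih₁ ih₂ hd hn
  | step X X' C hX h hd hn ih => exact .step _ _ _ (hX.trans hb) ih hd hn

lemma Dec.of_le_on (h : Dec H b X C)
    (hK : ∀ x ∈ X ∪ C, ∀ y ∈ X ∪ C, K.Adj x y → H.Adj x y) : Dec K b X C := by
  induction h with
  | nil X hX => exact .nil _ hX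
  | union X C₁ C₂ h₁ h₂ hd hn ih₁ ih₂ =>
    refine .union _ _ _ (ih₁ ?_) (ih₂ ?_) hd ?_
    · intro x hx y hy
      exact hK x (by simp only [mem_union] at hx ⊢; tauto) y
        (by simp only [mem_union] at hy ⊢; tauto)
    · intro x hx y hy
      exact hK x (by simp only [mem_union] at hx ⊢; tauto) y
        (by simp only [mem_union] at hy ⊢; tauto)
    · intro x hx y hy hxy
      exact hn x hx y hy (hK x (by simp [hx]) y (by simp [hy]) hxy)
  | step X X' C hX h hd hn ih =>
    refine .step _ _ _ hX (ih ?_) hd ?_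
    · intro x hx y hy
      exact hK x (by simp only [mem_union, mem_sdiff] at hx ⊢; tauto) y
        (by simp only [mem_union, mem_sdiff] at hy ⊢; tauto)
    · intro x hx y hy hxy
      exact hn x hx y hy (hK x (mem_union_right _ hx) y (by simp [(mem_sdiff.1 hy).1]) hxy)

/-- `Z` is put into every bag. It may overlap the root bag but not `C`, whose vertices are by
definition outside the root bag. -/
lemma Dec.union_bags (h : Dec H b X C) (Z : Finset α) (hZ : Disjoint Z C) :
    Dec H (b + Z.card) (X ∪ Z) C := by
  induction h with
  | nil X hX => exact .nil _ ((card_union_le _ _).trans (by omega))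
  | union X C₁ C₂ h₁ h₂ hd hn ih₁ ih₂ =>
    rw [disjoint_union_right] at hZ
    exact .union _ _ _ (ih₁ hZ.1) (ih₂ hZ.2) hd hn
  | step X X' C hX h hd hn ih =>
    rw [disjoint_union_right] at hZ
    have e : (X' \ X) ∪ C = ((X' ∪ Z) \ (X ∪ Z)) ∪ C := by
      ext x
      have : x ∈ Z → x ∉ X' \ X := fun h => disjoint_left.1 hZ.1 h
      simp only [mem_union, mem_sdiff] at this ⊢; tauto
    rw [e]
    refine .step _ _ _ ((card_union_le _ _).trans (by omega)) (ih hZ.2)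
      (disjoint_union_left.2 ⟨hd, hZ.2⟩) ?_
    intro x hx y hy
    rw [← e] at hx
    refine hn x hx y ?_
    simp only [mem_union, mem_sdiff] at hy ⊢; tauto

lemma Small.empty : Small H b ∅ := .nil _ (by simp)

lemma Small.subset (h : Small H b S) (hTS : T ⊆ S) : Small H b T := by
  have := Dec.inter h T
  rwa [empty_inter, inter_eq_right.2 hTS] at this

lemma Small.mono {b' : ℕ} (h : Small H b S) (hb : b ≤ b') : Small H b' S := Dec.mono_right h hb

lemma Small.of_le_on (h : Small H b S)
    (hK : ∀ x ∈ S, ∀ y ∈ S, K.Adj x y → H.Adj x y) : Small K b S :=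
  Dec.of_le_on h (by simpa using hK)

lemma Small.union (hS : Small H b S) (hT : Small H b T) (hd : Disjoint S T)
    (hn : ∀ x ∈ S, ∀ y ∈ T, ¬ H.Adj x y) : Small H b (S ∪ T) := Dec.union _ _ _ hS hT hd hn

lemma Small.of_card_le (h : S.card ≤ b) : Small H b S := by
  have := Dec.step ∅ S ∅ (by simp) (Dec.nil (H := H) S h) (by simp) (by simp)
  rwa [sdiff_empty, union_empty] at this

lemma Small.union_card (h : Small H b S) (Z : Finset α) : Small H (b + Z.card) (S ∪ Z) := by
  have h1 := Dec.union_bags (h.subset (sdiff_subset (t := Z))) Z disjoint_sdiff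
  rw [empty_union] at h1
  have := Dec.step ∅ Z _ (by simp) h1 (by simp) (by simp)
  have e : Z \ ∅ ∪ S \ Z = S ∪ Z := by ext x; simp only [mem_union, mem_sdiff, notMem_empty]; tauto
  rwa [e] at this

/-- If no edge joins different classes of `f` on `S`, and every class is small, so is `S`. -/
lemma Small.of_classes (f : α → ℕ) (hf : ∀ i, Small H b {x ∈ S | f x = i})
    (hn : ∀ x ∈ S, ∀ y ∈ S, H.Adj x y → f x = f y) : Small H b S := by
  have key : ∀ n, Small H b {x ∈ S | f x < n} := by
    intro n
    induction n with
    | zero => simpa using Small.empty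
    | succ n ih =>
      have := ih.union (hf n) (by
        rw [disjoint_left]; intro x; simp only [mem_filter]; intro h1 h2; omega) (by
        intro x hx y hy hxy
        simp only [mem_filter] at hx hy
        have := hn x hx.1 y hy.1 hxy
        omega)
      refine this.subset fun x hx => ?_
      simp only [mem_filter, mem_union] at hx ⊢
      rcases hx with ⟨h1, h2⟩
      rcases Nat.lt_succ_iff_lt_or_eq.1 h2 with h | h <;> simp [h1, h]
  refine (key (S.sup f + 1)).subset fun x hx => ?_
  simp only [mem_filter]
  exact ⟨hx, Nat.lt_succ_of_le (le_sup (f := f) hx)⟩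

/-! ### Breaking a decomposition into light pieces; a separator with small complement -/

set_option maxHeartbeats 1000000 in
/-- A graph with a decomposition into bags of size at most `b` can be broken into pieces of weight
at most `θ` by deleting about `b * w(C) / θ` vertices. Class `0` of the labelling `q` is the piece
which may still be attached to the root bag. -/
lemma Dec.exists_break (h : Dec H b X C) (w : α → ℕ) (θ : ℕ) :
    ∃ (Z : Finset α) (q : α → ℕ), Z ⊆ X ∪ C ∧
      Z.card * θ + b * ∑ x ∈ C \ Z with q x = 0, w x ≤ b * ∑ x ∈ C, w x ∧
      (∀ x ∈ C \ Z, ∀ y ∈ C \ Z, H.Adj x y → q x = q y) ∧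
      (∀ x ∈ C \ Z, ∀ y ∈ X \ Z, H.Adj x y → q x = 0) ∧
      ∀ i, ∑ x ∈ C \ Z with q x = i, w x ≤ θ := by
  induction h with
  | nil X hX => exact ⟨∅, 0, by simp, by simp, by simp, by simp, by simp⟩
  | union X C₁ C₂ h₁ h₂ hd hn ih₁ ih₂ =>
    obtain ⟨Z₁, q₁, hZ₁, hw₁, ha₁, hb₁, hc₁⟩ := ih₁
    obtain ⟨Z₂, q₂, hZ₂, hw₂, ha₂, hb₂, hc₂⟩ := ih₂
    have hXb := h₁.card_le
    have hX₁ := h₁.disjoint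
    have hX₂ := h₂.disjoint
    have hd' : ∀ x ∈ C₁, x ∉ C₂ := fun x hx => disjoint_left.1 hd hx
    have m₁ : ∀ x ∈ C₁, x ∉ Z₂ := fun x hx hx2 => by
      have := hZ₂ hx2
      rw [mem_union] at this
      exact this.elim (fun h => disjoint_left.1 hX₁ h hx) (hd' x hx)
    have m₂ : ∀ x ∈ C₂, x ∉ Z₁ := fun x hx hx2 => by
      have := hZ₁ hx2
      rw [mem_union] at this
      exact this.elim (fun h => disjoint_left.1 hX₂ h hx) (fun h => hd' x h hx)
    have hX₁' : ∀ x ∈ C₁, x ∉ X := fun x hx h => disjoint_left.1 hX₁ h hx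
    have hX₂' : ∀ x ∈ C₂, x ∉ X := fun x hx h => disjoint_left.1 hX₂ h hx
    have hn' : ∀ x ∈ C₁, ∀ y ∈ C₂, ¬ H.Adj y x := fun x hx y hy h => hn x hx y hy h.symm
    have hCC : ∑ x ∈ C₁ ∪ C₂, w x = ∑ x ∈ C₁, w x + ∑ x ∈ C₂, w x := sum_union hd
    -- The open pieces are merged while they stay light. Otherwise the root bag is deleted: its at
    -- most `b` vertices cost at most `b * θ`, paid for by `b` times the weight, above `θ`, of the
    -- pieces that get closed.
    by_cases hR : ∑ x ∈ C₁ \ Z₁ with q₁ x = 0, w x + ∑ x ∈ C₂ \ Z₂ with q₂ x = 0, w x ≤ θ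
    · have e0 : ∀ q : α → ℕ, (∀ x ∈ C₁, (q x = 0 ↔ q₁ x = 0)) → (∀ x ∈ C₂, (q x = 0 ↔ q₂ x = 0)) →
          ∑ x ∈ (C₁ ∪ C₂) \ (Z₁ ∪ Z₂) with q x = 0, w x =
          ∑ x ∈ C₁ \ Z₁ with q₁ x = 0, w x + ∑ x ∈ C₂ \ Z₂ with q₂ x = 0, w x := by
        intro q h1 h2
        rw [← sum_union]
        · refine sum_congr ?_ fun _ _ => rfl
          ext x
          by_cases x1 : x ∈ C₁
          · simp [x1, hd' x x1, m₁ x x1, h1 x x1]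
          · by_cases x2 : x ∈ C₂
            · simp [x1, x2, m₂ x x2, h2 x x2]
            · simp [x1, x2]
        · exact hd.mono ((filter_subset _ _).trans sdiff_subset)
            ((filter_subset _ _).trans sdiff_subset)
      -- Doubling keeps closed pieces of the two sides apart by parity, while the open pieces share
      -- the label `0`.
      refine ⟨Z₁ ∪ Z₂, fun x => if x ∈ C₁ then 2 * q₁ x else if q₂ x = 0 then 0 else 2 * q₂ x + 1,
        ?_, ?_, ?_, ?_, ?_⟩
      · intro x hx
        have := @hZ₁ x; have := @hZ₂ x
        simp only [mem_union] at *; tauto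
      · rw [e0, hCC]
        · have := Nat.mul_le_mul_right θ (card_union_le Z₁ Z₂)
          nlinarith
        · intro x hx; simp [hx]
        · intro x hx
          have : x ∉ C₁ := fun h => hd' x h hx
          simp [this]
      · intro x hx y hy hxy
        simp only [mem_sdiff, mem_union, not_or] at hx hy
        rcases hx.1 with hx1 | hx1 <;> rcases hy.1 with hy1 | hy1
        · simp only [hx1, hy1, if_true]
          rw [ha₁ x (by simp [hx1, hx.2]) y (by simp [hy1, hy.2]) hxy]
        · exact absurd hxy (hn x hx1 y hy1)
        · exact absurd hxy (hn' y hy1 x hx1)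
        · have hx2 : x ∉ C₁ := fun h => hd' x h hx1
          have hy2 : y ∉ C₁ := fun h => hd' y h hy1
          simp only [hx2, hy2, if_false]
          rw [ha₂ x (by simp [hx1, hx.2]) y (by simp [hy1, hy.2]) hxy]
      · intro x hx y hy hxy
        simp only [mem_sdiff, mem_union, not_or] at hx hy
        rcases hx.1 with hx1 | hx1
        · simp [hx1, hb₁ x (by simp [hx1, hx.2]) y (by simp [hy]) hxy]
        · have hx2 : x ∉ C₁ := fun h => hd' x h hx1
          simp [hx2, hb₂ x (by simp [hx1, hx.2]) y (by simp [hy]) hxy]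
      · intro i
        rcases Nat.eq_zero_or_pos i with rfl | hi
        · rw [e0]
          · exact hR
          · intro x hx; simp [hx]
          · intro x hx
            have : x ∉ C₁ := fun h => hd' x h hx
            simp [this]
        · rcases Nat.even_or_odd' i with ⟨j, rfl | rfl⟩
          · refine le_trans (sum_le_sum_of_subset ?_) (hc₁ j)
            intro x hx
            simp only [mem_filter, mem_sdiff, mem_union, not_or] at hx ⊢
            split_ifs at hx with h1 h2
            · exact ⟨⟨h1, hx.1.2.1⟩, by omega⟩
            · omega
            · omega
          · refine le_trans (sum_le_sum_of_subset ?_) (hc₂ j)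
            intro x hx
            simp only [mem_filter, mem_sdiff, mem_union, not_or] at hx ⊢
            split_ifs at hx with h1 h2
            · omega
            · exact absurd hx.2 (by simp)
            · exact ⟨⟨by tauto, hx.1.2.2⟩, by omega⟩
    -- With the root bag gone nothing is open, so all labels are positive, again separated by
    -- parity.
    · refine ⟨Z₁ ∪ Z₂ ∪ X, fun x => if x ∈ C₁ then 2 * q₁ x + 1 else 2 * q₂ x + 2,
        ?_, ?_, ?_, ?_, ?_⟩
      · intro x hx
        have := @hZ₁ x; have := @hZ₂ x
        simp only [mem_union] at *; tauto
      · have : ∑ x ∈ (C₁ ∪ C₂) \ (Z₁ ∪ Z₂ ∪ X) with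
            (if x ∈ C₁ then 2 * q₁ x + 1 else 2 * q₂ x + 2) = 0, w x = 0 := by
          rw [filter_false_of_mem]
          · simp
          · intro x _; by_cases h : x ∈ C₁ <;> simp [h]
        rw [this, hCC]
        have h3 := Nat.mul_le_mul_right θ ((card_union_le (Z₁ ∪ Z₂) X).trans
          (Nat.add_le_add (card_union_le Z₁ Z₂) hXb))
        push Not at hR
        have h4 := Nat.mul_le_mul_left b hR.le
        nlinarith
      · intro x hx y hy hxy
        simp only [mem_sdiff, mem_union, not_or] at hx hy
        rcases hx.1 with hx1 | hx1 <;> rcases hy.1 with hy1 | hy1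
        · simp only [hx1, hy1, if_true]
          rw [ha₁ x (by simp [hx1, hx.2]) y (by simp [hy1, hy.2]) hxy]
        · exact absurd hxy (hn x hx1 y hy1)
        · exact absurd hxy (hn' y hy1 x hx1)
        · have hx2 : x ∉ C₁ := fun h => hd' x h hx1
          have hy2 : y ∉ C₁ := fun h => hd' y h hy1
          simp only [hx2, hy2, if_false]
          rw [ha₂ x (by simp [hx1, hx.2]) y (by simp [hy1, hy.2]) hxy]
      · intro x hx y hy hxy
        simp only [mem_sdiff, mem_union, not_or] at hy
        tauto
      · intro i
        rcases Nat.even_or_odd' i with ⟨j, rfl | rfl⟩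
        · refine le_trans (sum_le_sum_of_subset ?_) (hc₂ (j - 1))
          intro x hx
          simp only [mem_filter, mem_sdiff, mem_union, not_or] at hx ⊢
          split_ifs at hx with h1
          · omega
          · exact ⟨⟨by tauto, hx.1.2.1.2⟩, by omega⟩
        · refine le_trans (sum_le_sum_of_subset ?_) (hc₁ j)
          intro x hx
          simp only [mem_filter, mem_sdiff, mem_union, not_or] at hx ⊢
          split_ifs at hx with h1
          · exact ⟨⟨h1, hx.1.2.1.1⟩, by omega⟩
          · omega
  | step X X' C hX h hd hn ih =>
    replace hn : ∀ x ∈ C, ∀ y ∈ X \ X', ¬ H.Adj x y := fun x hx => hn x (mem_union_right _ hx)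
    obtain ⟨Z, q, hZ, hw, ha, hb, hc⟩ := ih
    have hXb := h.card_le
    have hX' : ∀ x ∈ C, x ∉ X' := fun x hx h' => disjoint_left.1 h.disjoint h' hx
    have hX : ∀ x ∈ C, x ∉ X := fun x hx h' => disjoint_left.1 hd h' hx
    have hCC : ∑ x ∈ X' \ X ∪ C, w x = ∑ x ∈ X' \ X, w x + ∑ x ∈ C, w x :=
      sum_union (h.disjoint.mono_left sdiff_subset)
    have hR0 : ∑ x ∈ (X' \ X ∪ C) \ Z with (if x ∈ C then q x else 0) = 0, w x =
        ∑ x ∈ (X' \ X) \ Z, w x + ∑ x ∈ C \ Z with q x = 0, w x := by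
      rw [← sum_union]
      · refine sum_congr ?_ fun _ _ => rfl
        ext x
        have := hX' x; have := hX x
        by_cases hxC : x ∈ C <;>
          simp only [hxC, mem_filter, mem_union, mem_sdiff, if_true, if_false]
        · tauto
        · tauto
      · exact h.disjoint.mono (sdiff_subset.trans sdiff_subset)
          ((filter_subset _ _).trans sdiff_subset)
    have hsub : ∑ x ∈ (X' \ X) \ Z, w x ≤ ∑ x ∈ X' \ X, w x := sum_le_sum_of_subset sdiff_subset
    by_cases hR : ∑ x ∈ (X' \ X) \ Z, w x + ∑ x ∈ C \ Z with q x = 0, w x ≤ θ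
    · refine ⟨Z, fun x => if x ∈ C then q x else 0, ?_, ?_, ?_, ?_, ?_⟩
      · intro x hx
        have := hZ hx
        simp only [mem_union, mem_sdiff] at this ⊢; tauto
      · rw [hR0, hCC]
        nlinarith [Nat.mul_le_mul_left b hsub]
      · intro x hx y hy hxy
        simp only [mem_sdiff, mem_union] at hx hy
        by_cases hx1 : x ∈ C <;> by_cases hy1 : y ∈ C <;> simp only [hx1, hy1, if_true, if_false]
        · exact ha x (by simp [hx1, hx.2]) y (by simp [hy1, hy.2]) hxy
        · exact hb x (by simp [hx1, hx.2]) y (by simp only [mem_sdiff]; tauto) hxy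
        · exact (hb y (by simp [hy1, hy.2]) x (by simp only [mem_sdiff]; tauto) hxy.symm).symm
      · intro x hx y hy hxy
        simp only [mem_sdiff, mem_union] at hx hy
        by_cases hx1 : x ∈ C <;> simp only [hx1, if_true, if_false]
        by_cases hy1 : y ∈ X'
        · exact hb x (by simp [hx1, hx.2]) y (by simp [hy1, hy.2]) hxy
        · exact absurd hxy (hn x hx1 y (by simp [hy, hy1]))
      · intro i
        rcases Nat.eq_zero_or_pos i with rfl | hi
        · rw [hR0]; exact hR
        · refine le_trans (sum_le_sum_of_subset ?_) (hc i)
          intro x hx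
          simp only [mem_filter, mem_sdiff, mem_union] at hx ⊢
          split_ifs at hx with h1
          · exact ⟨⟨h1, hx.1.2⟩, hx.2⟩
          · omega
    -- Deleting `X'` removes every vertex new to the piece and cuts `C` from `X`, because all
    -- neighbours of `C` in `X` lie in `X'`. The shift closes the old class `0`.
    · refine ⟨Z ∪ X', fun x => q x + 1, ?_, ?_, ?_, ?_, ?_⟩
      · intro x hx
        have := @hZ x
        simp only [mem_union, mem_sdiff] at *; tauto
      · have : ∑ x ∈ (X' \ X ∪ C) \ (Z ∪ X') with q x + 1 = 0, w x = 0 := by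
          rw [filter_false_of_mem]
          · simp
          · intro x _; omega
        rw [this, hCC]
        have h3 := Nat.mul_le_mul_right θ ((card_union_le Z X').trans
          (Nat.add_le_add_left hXb _))
        push Not at hR
        have h4 := Nat.mul_le_mul_left b hR.le
        nlinarith [Nat.mul_le_mul_left b hsub]
      · intro x hx y hy hxy
        simp only [mem_sdiff, mem_union] at hx hy
        exact congrArg (· + 1)
          (ha x (by simp only [mem_sdiff]; tauto) y (by simp only [mem_sdiff]; tauto) hxy)
      · intro x hx y hy hxy
        simp only [mem_sdiff, mem_union] at hx hy
        exact absurd hxy (hn x (by tauto) y (by simp only [mem_sdiff]; tauto))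
      · intro i
        refine le_trans (sum_le_sum_of_subset ?_) (hc (i - 1))
        intro x hx
        simp only [mem_filter, mem_sdiff, mem_union] at hx ⊢
        exact ⟨by tauto, by omega⟩

/-- If of any two disjoint sets one is small, then some set of at most `b` vertices has a small
complement. -/
lemma Dec.small_or_exists_small_compl {V : Finset α} {t : ℕ}
    (hV : ∀ A ⊆ V, ∀ B ⊆ V, Disjoint A B → Small H t A ∨ Small H t B)
    (h : Dec H b X C) (hC : C ⊆ V)
    (hN : ∀ x ∈ C, ∀ y ∈ V, H.Adj x y → y ∈ X ∪ C) :
    Small H t C ∨ ∃ W : Finset α, W.card ≤ b ∧ Small H t (V \ W) := by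
  induction h with
  | nil X hX => exact .inl .empty
  | union X C₁ C₂ h₁ h₂ hd hn ih₁ ih₂ =>
    rw [union_subset_iff] at hC
    rcases ih₁ hC.1 (fun x hx y hy hxy => by
      have := hN x (by simp [hx]) y hy hxy
      have := hn x hx y
      simp only [mem_union] at *; tauto) with h1 | h1
    · rcases ih₂ hC.2 (fun x hx y hy hxy => by
        have := hN x (by simp [hx]) y hy hxy
        have := fun h => hn y h x hx hxy.symm
        simp only [mem_union] at *; tauto) with h2 | h2
      · exact .inl (h1.union h2 hd hn)
      · exact .inr h2
    · exact .inr h1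
  | step X X' C hX h hd hn ih =>
    have hN' : ∀ x ∈ C, ∀ y ∈ V, H.Adj x y → y ∈ X' ∪ C := fun x hx y hy hxy => by
      have := hN x (by simp [hx]) y hy hxy
      have := hn x (mem_union_right _ hx) y
      simp only [mem_union, mem_sdiff] at *; tauto
    rcases ih (subset_union_right.trans hC) hN' with h1 | h1
    · by_cases h2 : Small H t (X' \ X ∪ C)
      · exact .inl h2
      -- Here the part below the bag stops being small, so its complement is small. Removing `X'`
      -- leaves the small `C` and part of that complement, with no edges between them.
      · have h3 := (hV _ hC (V \ (X' \ X ∪ C)) sdiff_subset disjoint_sdiff).resolve_left h2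
        refine .inr ⟨X', h.card_le, ?_⟩
        have h4 : Small H t (V \ (X' ∪ C)) := h3.subset fun x hx => by
          simp only [mem_union, mem_sdiff] at *; tauto
        have := h1.union h4 (by
          rw [disjoint_left]; intro x hx; simp [hx]) (by
          intro x hx y hy hxy
          have := hN' x hx y (mem_sdiff.1 hy).1 hxy
          exact (mem_sdiff.1 hy).2 this)
        refine this.subset fun x hx => ?_
        simp only [mem_union, mem_sdiff] at *; tauto
    · exact .inr h1

end TreewidthSplit

/-! ### Partitions into small classes with few crossing pairs -/

namespace TreewidthSplit

open Finset
open scoped Classical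

variable {α : Type u} {H : SimpleGraph α} {S V : Finset α} {t : ℕ}

/-- Consecutive classes of weight at most `θ` can be merged into few classes of weight at most
`τ + θ`. -/
lemma exists_merge (w q : α → ℕ) (S : Finset α) {θ τ : ℕ} (hτ : 0 < τ)
    (hq : ∀ i, ∑ x ∈ S with q x = i, w x ≤ θ) :
    ∃ q' : α → ℕ, (∀ x y, q x = q y → q' x = q' y) ∧ (∀ x, q' x ≤ (∑ x ∈ S, w x) / τ) ∧
      ∀ i, ∑ x ∈ S with q' x = i, w x ≤ τ + θ := by
  -- The new label is the total weight of the earlier classes, divided by `τ` and rounded down.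
  refine ⟨fun x => (∑ y ∈ S with q y < q x, w y) / τ, fun x y h => by simp [h],
    fun x => Nat.div_le_div_right (sum_le_sum_of_subset (filter_subset _ _)), fun c => ?_⟩
  set p : ℕ → ℕ := fun n => ∑ y ∈ S with q y < n, w y with hp
  have psucc : ∀ n, p (n + 1) = p n + ∑ x ∈ S with q x = n, w x := by
    intro n
    rw [hp]
    simp only
    rw [← sum_union]
    · refine sum_congr ?_ fun _ _ => rfl
      ext x
      simp only [mem_filter, mem_union, Nat.lt_succ_iff_lt_or_eq]; tauto
    · rw [disjoint_left]; intro x; simp only [mem_filter]; intro h1 h2; omega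
  -- A group `c` of nonzero weight occupies prefix weights from `c * τ` on, and its last class
  -- begins before `(c + 1) * τ`; so it exceeds `τ` by at most one class.
  have key : ∀ n, ∑ x ∈ S with q x < n ∧ p (q x) / τ = c, w x ≤ τ + θ ∧
      (∑ x ∈ S with q x < n ∧ p (q x) / τ = c, w x + c * τ ≤ p n ∨
        ∑ x ∈ S with q x < n ∧ p (q x) / τ = c, w x = 0) := by
    intro n
    induction n with
    | zero => simp
    | succ n ih =>
      by_cases hn : p n / τ = c
      · have e : ∑ x ∈ S with q x < n + 1 ∧ p (q x) / τ = c, w x =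
            ∑ x ∈ S with q x < n ∧ p (q x) / τ = c, w x + ∑ x ∈ S with q x = n, w x := by
          rw [← sum_union]
          · refine sum_congr ?_ fun _ _ => rfl
            ext x
            simp only [mem_filter, mem_union, Nat.lt_succ_iff_lt_or_eq]
            constructor
            · tauto
            · rintro (h | h)
              · tauto
              · refine ⟨h.1, .inr h.2, by rw [h.2, hn]⟩
          · rw [disjoint_left]; intro x; simp only [mem_filter]; intro h1 h2; omega
        have h1 := hq n
        have h2 : c * τ ≤ p n := by rw [← hn]; exact Nat.div_mul_le_self _ _
        have h3 : p n < c * τ + τ := by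
          have := Nat.lt_mul_div_succ (p n) hτ
          rw [hn] at this; linarith
        rw [e, psucc]
        rcases ih with ⟨_, h4 | h4⟩
        · exact ⟨by omega, .inl (by omega)⟩
        · exact ⟨by omega, .inl (by omega)⟩
      · have e : ∑ x ∈ S with q x < n + 1 ∧ p (q x) / τ = c, w x =
            ∑ x ∈ S with q x < n ∧ p (q x) / τ = c, w x := by
          refine sum_congr ?_ fun _ _ => rfl
          ext x
          simp only [mem_filter, Nat.lt_succ_iff_lt_or_eq]
          constructor
          · rintro ⟨h1, h2 | h2, h3⟩
            · exact ⟨h1, h2, h3⟩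
            · rw [h2] at h3; exact absurd h3 hn
          · tauto
        rw [e, psucc]
        exact ⟨ih.1, ih.2.imp (fun h => by omega) id⟩
  refine le_trans (sum_le_sum_of_subset ?_) (key (S.sup q + 1)).1
  intro x hx
  simp only [mem_filter] at hx ⊢
  exact ⟨hx.1, Nat.lt_succ_of_le (le_sup (f := q) hx.1), hx.2⟩

/-- The ordered pairs of adjacent vertices of `S` in different classes of `f`. -/
noncomputable def cross (H : SimpleGraph α) (S : Finset α) (f : α → ℕ) : Finset (α × α) :=
  {p ∈ S ×ˢ S | H.Adj p.1 p.2 ∧ f p.1 ≠ f p.2}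

lemma mem_cross {f : α → ℕ} {p : α × α} :
    p ∈ cross H S f ↔ (p.1 ∈ S ∧ p.2 ∈ S) ∧ H.Adj p.1 p.2 ∧ f p.1 ≠ f p.2 := by
  simp [cross]

lemma card_cross_fst (f : α → ℕ) (P : α → Prop) [DecidablePred P] :
    #{p ∈ cross H S f | P p.1} = ∑ x ∈ S with P x, #{y ∈ S | H.Adj x y ∧ f x ≠ f y} := by
  rw [← card_sigma]
  refine card_bij' (fun p _ => ⟨p.1, p.2⟩) (fun p _ => (p.1, p.2)) ?_ ?_ ?_ ?_
  · intro p hp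
    simp only [mem_filter, mem_cross] at hp
    simp only [mem_sigma, mem_filter]; tauto
  · intro p hp
    simp only [mem_sigma, mem_filter] at hp
    simp only [mem_filter, mem_cross]; tauto
  · intros; rfl
  · intros; rfl

lemma card_cross_snd (f : α → ℕ) (P : α → Prop) [DecidablePred P] :
    #{p ∈ cross H S f | P p.2} = #{p ∈ cross H S f | P p.1} := by
  refine card_bij' (fun p _ => p.swap) (fun p _ => p.swap) ?_ ?_ ?_ ?_
  · intro p hp
    simp only [mem_filter, mem_cross, Prod.fst_swap, Prod.snd_swap] at hp ⊢
    exact ⟨⟨hp.1.1.symm, hp.1.2.1.symm, hp.1.2.2.symm⟩, hp.2⟩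
  · intro p hp
    simp only [mem_filter, mem_cross, Prod.fst_swap, Prod.snd_swap] at hp ⊢
    exact ⟨⟨hp.1.1.symm, hp.1.2.1.symm, hp.1.2.2.symm⟩, hp.2⟩
  · intros; simp
  · intros; simp

/-- Some pair of values is taken by at least a `1 / n ^ 2` fraction of the pairs. -/
lemma exists_heavy_pair (E : Finset (α × α)) (q : α → ℕ) {n : ℕ} (hn : 0 < n)
    (hq : ∀ x, q x < n) :
    ∃ a b, #E ≤ n * n * #{p ∈ E | q p.1 = a ∧ q p.2 = b} := by
  by_contra! hcon
  have h1 : #E = ∑ c ∈ range n ×ˢ range n, #{p ∈ E | (q p.1, q p.2) = c} :=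
    card_eq_sum_card_fiberwise (fun p _ => by simp [hq])
  have h2 : ∑ c ∈ range n ×ˢ range n, n * n * #{p ∈ E | (q p.1, q p.2) = c} <
      ∑ c ∈ range n ×ˢ range n, #E := by
    refine sum_lt_sum_of_nonempty ⟨(0, 0), by simp [hn]⟩ ?_
    rintro ⟨a, b⟩ _
    simpa using hcon a b
  rw [← mul_sum, ← h1] at h2
  simp at h2

/-- If of any two disjoint sets one is small, then a partition into small classes can be improved:
after deleting `O(t)` vertices there is another such partition with a constant fraction of the
crossing pairs removed. -/
lemma exists_fewer_cross
    (hV : ∀ A ⊆ V, ∀ B ⊆ V, Disjoint A B → Small H t A ∨ Small H t B)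
    {Z : Finset α} {f : α → ℕ} (hZ : Z ⊆ V) (hf : ∀ i, Small H t {x ∈ V \ Z | f x = i})
    (hM : 48 ≤ #(cross H (V \ Z) f)) :
    ∃ (Z' : Finset α) (f' : α → ℕ), Z' ⊆ V ∧ (∀ i, Small H t {x ∈ V \ Z' | f' x = i}) ∧
      #Z' ≤ #Z + 36 * t ∧ 3000 * #(cross H (V \ Z') f') ≤ 2999 * #(cross H (V \ Z) f) := by
  set M := #(cross H (V \ Z) f) with hMdef
  set S := V \ Z with hS
  set w : α → ℕ := fun x => #{y ∈ S | H.Adj x y ∧ f x ≠ f y} with hw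
  have hwM : ∑ x ∈ S, w x = M := by
    have := card_cross_fst (H := H) (S := S) f (fun _ => True)
    simpa using this.symm
  -- Four groups' worth of weight `2θ` must stay below `M / 2`, which `8θ ≤ M / 3` ensures. Rounding
  -- is harmless: `48 ≤ M` still gives `M < 36θ`.
  set θ := M / 24 with hθ
  have hθ1 : 24 * θ ≤ M := Nat.mul_div_le _ _
  have hθ2 : M < 36 * θ := by omega
  -- Only edges inside classes matter for the breaking. Afterwards every surviving edge either
  -- crosses `f` or stays within one piece.
  let K : SimpleGraph α :=
    { Adj := fun x y => H.Adj x y ∧ f x = f y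
      symm := ⟨fun x y h => ⟨h.1.symm, h.2.symm⟩⟩
      loopless := ⟨fun x h => H.loopless.irrefl x h.1⟩ }
  have hK : Small K t S :=
    Small.of_classes f (fun i => (hf i).of_le_on fun x _ y _ h => h.1) fun x _ y _ h => h.2
  obtain ⟨Z₁, q, hZ₁, hq1, hq2, -, hq3⟩ := Dec.exists_break hK w θ
  rw [empty_union] at hZ₁
  rw [hwM] at hq1
  have hZcard : #Z₁ ≤ 36 * t := by
    have h1 : #Z₁ * θ ≤ t * M := by omega
    have h2 : t * M ≤ 36 * t * θ := by nlinarith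
    exact Nat.le_of_mul_le_mul_right (h1.trans h2) (by omega)
  obtain ⟨q', hqq, hq'b, hq'w⟩ := exists_merge w q (S \ Z₁) (by omega : 0 < θ) hq3
  have hwM' : ∑ x ∈ S \ Z₁, w x ≤ M := hwM ▸ sum_le_sum_of_subset sdiff_subset
  have hq'36 : ∀ x, q' x < 36 := fun x =>
    lt_of_le_of_lt ((hq'b x).trans (Nat.div_le_div_right hwM')) (Nat.div_lt_of_lt_mul (by omega))
  have hVS : V \ (Z ∪ Z₁) = S \ Z₁ := by 
    ext x; simp only [hS, mem_sdiff, mem_union]; tauto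
  have hZV : Z ∪ Z₁ ⊆ V := union_subset hZ (hZ₁.trans sdiff_subset)
  have hcard : #(Z ∪ Z₁) ≤ #Z + 36 * t := (card_union_le _ _).trans (by omega)
  set S' := S \ Z₁ with hS'
  have hS'V : S' ⊆ V := sdiff_subset.trans sdiff_subset
  have hclass : ∀ i, Small H t {x ∈ S' | f x = i} := fun i =>
    (hf i).subset (filter_subset_filter _ sdiff_subset)
  set E := cross H S' f with hE
  have hEsub : E ⊆ cross H S f := fun p hp => by
    rw [mem_cross] at hp ⊢
    exact ⟨⟨sdiff_subset hp.1.1, sdiff_subset hp.1.2⟩, hp.2⟩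
  have hEM : #E ≤ M := card_le_card hEsub
  by_cases hEhalf : 2 * #E ≤ M
  · exact ⟨Z ∪ Z₁, f, hZV, by rw [hVS]; exact hclass, hcard, by
      rw [hVS, ← hE]; omega⟩
  by_cases hsm : Small H t S'
  · refine ⟨Z ∪ Z₁, 0, hZV, fun i => by rw [hVS]; exact hsm.subset (filter_subset _ _), hcard, ?_⟩
    have : cross H (V \ (Z ∪ Z₁)) 0 = ∅ := by
      ext p; simp [mem_cross]
    rw [this]; simp
  obtain ⟨a, b, hab⟩ := exists_heavy_pair E q' (by omega : 0 < 36) hq'36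
  set U : α → Prop := fun x => q' x = a ∨ q' x = b with hU
  have hin : #E ≤ 1296 * #{p ∈ E | U p.1 ∧ U p.2} := by
    refine hab.trans (Nat.mul_le_mul_left _ (card_le_card ?_))
    intro p hp
    simp only [mem_filter, hU] at hp ⊢
    exact ⟨hp.1, .inl hp.2.1, .inr hp.2.2⟩
  have hU1 : #{p ∈ E | U p.1} ≤ 4 * θ := by
    rw [hE, card_cross_fst f U]
    calc ∑ x ∈ S' with U x, #{y ∈ S' | H.Adj x y ∧ f x ≠ f y}
        ≤ ∑ x ∈ S' with U x, w x := sum_le_sum fun x _ => card_le_card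
          (filter_subset_filter _ sdiff_subset)
      _ ≤ ∑ x ∈ {x ∈ S' | q' x = a} ∪ {x ∈ S' | q' x = b}, w x := by
          refine sum_le_sum_of_subset fun x hx => ?_
          simp only [mem_filter, mem_union, hU] at hx ⊢; tauto
      _ ≤ ∑ x ∈ S' with q' x = a, w x + ∑ x ∈ S' with q' x = b, w x := by
          rw [← sum_union_inter]; exact Nat.le_add_right _ _
      _ ≤ 4 * θ := by have := hq'w a; have := hq'w b; omega
  have hU2 : #{p ∈ E | U p.2} ≤ 4 * θ := (card_cross_snd f U).le.trans hU1
  -- Since `#E` exceeds `M / 2` and `8θ ≤ M / 3`, more than `M / 6` pairs avoid `U` entirely.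
  have hout : #E ≤ #{p ∈ E | ¬ U p.1 ∧ ¬ U p.2} + 8 * θ := by
    have : E ⊆ {p ∈ E | ¬ U p.1 ∧ ¬ U p.2} ∪ ({p ∈ E | U p.1} ∪ {p ∈ E | U p.2}) := by
      intro p hp
      simp only [mem_filter, mem_union]; tauto
    have := card_le_card this
    have := card_union_le {p ∈ E | ¬ U p.1 ∧ ¬ U p.2} ({p ∈ E | U p.1} ∪ {p ∈ E | U p.2})
    have := card_union_le {p ∈ E | U p.1} {p ∈ E | U p.2}
    omega
  set N := S'.sup f + 1 with hN
  have hfN : ∀ x ∈ S', f x < N := fun x hx => Nat.lt_succ_of_le (le_sup (f := f) hx)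
  -- Values below `N` list the fragments of classes inside `U`, later values those outside. Edges
  -- not crossing `f` do not cross `h`, as they stay within one group.
  set h : α → ℕ := fun x => if U x then f x else N + f x with hh
  have hhf : ∀ x ∈ S', ∀ y ∈ S', H.Adj x y → f x = f y → h x = h y := by
    intro x hx y hy hxy hfxy
    have h1 := hqq x y (hq2 x hx y hy ⟨hxy, hfxy⟩)
    simp only [hh, hU, h1, hfxy]
  have hex : ∃ n, ¬ Small H t {x ∈ S' | h x < n} := by
    refine ⟨N + N, fun hc => hsm (hc.subset fun x hx => ?_)⟩
    have := hfN x hx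
    simp only [mem_filter, hh]
    refine ⟨hx, ?_⟩
    split_ifs <;> omega
  -- Level `m` is where the initial union first fails to be small. Below it minimality gives
  -- smallness, level `m` lies in one class of `f`, and the part above is disjoint from a non-small
  -- set.
  obtain ⟨m, hm⟩ : ∃ m, Nat.find hex = m + 1 := by
    refine Nat.exists_eq_succ_of_ne_zero fun h0 => ?_
    have := Nat.find_spec hex
    rw [h0] at this
    exact this (by simpa using Small.empty)
  have hlarge : ¬ Small H t {x ∈ S' | h x < m + 1} := hm ▸ Nat.find_spec hex
  have hA : Small H t {x ∈ S' | h x < m} := by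
    by_contra hc
    have := Nat.find_min' hex hc
    omega
  have hp : Small H t {x ∈ S' | h x = m} := by
    refine (hclass (if m < N then m else m - N)).subset fun x hx => ?_
    simp only [mem_filter, hh] at hx ⊢
    have := hfN x hx.1
    refine ⟨hx.1, ?_⟩
    have h2 := hx.2
    split_ifs at h2 ⊢ <;> omega
  have hB : Small H t {x ∈ S' | m < h x} := by
    refine (hV {x ∈ S' | h x < m + 1} ((filter_subset _ _).trans hS'V) {x ∈ S' | m < h x}
      ((filter_subset _ _).trans hS'V) ?_).resolve_left hlarge
    rw [disjoint_left]; intro x; simp only [mem_filter]; intro h1 h2; omega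
  set f' : α → ℕ := fun x => if h x < m then 0 else if h x = m then 1 else 2 with hf'
  refine ⟨Z ∪ Z₁, f', hZV, ?_, hcard, ?_⟩
  · intro i
    rw [hVS]
    have hcase : i = 0 ∨ i = 1 ∨ 2 ≤ i := by omega
    rcases hcase with rfl | rfl | hi
    · refine hA.subset fun x hx => ?_
      simp only [mem_filter, hf'] at hx ⊢
      refine ⟨hx.1, ?_⟩
      have h2 := hx.2
      split_ifs at h2
      omega
    · refine hp.subset fun x hx => ?_
      simp only [mem_filter, hf'] at hx ⊢
      refine ⟨hx.1, ?_⟩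
      have h2 := hx.2
      split_ifs at h2 <;> omega
    · refine hB.subset fun x hx => ?_
      simp only [mem_filter, hf'] at hx ⊢
      refine ⟨hx.1, ?_⟩
      have h2 := hx.2
      split_ifs at h2 <;> omega
  · rw [hVS]
    have hsub : cross H S' f' ⊆ E := fun p hp => by
      rw [mem_cross] at hp ⊢
      refine ⟨hp.1, hp.2.1, fun hc => hp.2.2 ?_⟩
      simp only [hf', hhf _ hp.1.1 _ hp.1.2 hp.2.1 hc]
    have final : ∀ D ⊆ E, (∀ p ∈ D, f' p.1 = f' p.2) → M ≤ 3000 * #D →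
        3000 * #(cross H S' f') ≤ 2999 * M := by
      intro D hD hD' hDM
      have : cross H S' f' ⊆ E \ D := fun p hp =>
        mem_sdiff.2 ⟨hsub hp, fun hpD => (mem_cross.1 hp).2.2 (hD' p hpD)⟩
      have := card_le_card this
      rw [card_sdiff_of_subset hD] at this
      omega
    -- If the critical fragment is in `U`, all vertices outside `U` come after it, so more than `M /
    -- 6` pairs stop crossing. Otherwise all of `U` comes before it, which saves at least `#E / 1296
    -- > M / 2592` pairs. Either is at least `M / 3000`.
    by_cases hmN : m < N
    · refine final {p ∈ E | ¬ U p.1 ∧ ¬ U p.2} (filter_subset _ _) ?_ (by omega)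
      intro p hp
      simp only [mem_filter] at hp
      have h1 : m < h p.1 := by simp only [hh, hp.2.1, if_false]; omega
      have h2 : m < h p.2 := by simp only [hh, hp.2.2, if_false]; omega
      simp only [hf']
      rw [if_neg (by omega), if_neg (by omega), if_neg (by omega), if_neg (by omega)]
    · refine final {p ∈ E | U p.1 ∧ U p.2} (filter_subset _ _) ?_ (by omega)
      intro p hp
      simp only [mem_filter] at hp
      have hpS := (mem_cross.1 hp.1).1
      have h1 : h p.1 < m := by
        have := hfN _ hpS.1
        simp only [hh, hp.2.1, if_true]; omega
      have h2 : h p.2 < m := by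
        have := hfN _ hpS.2
        simp only [hh, hp.2.2, if_true]; omega
      simp only [hf']
      rw [if_pos h1, if_pos h2]

/-- If of any two disjoint sets of vertices one has treewidth less than `t`, then the whole graph
has treewidth `O(Δ t)`. -/
theorem small_of_forall_disjoint {Δ : ℕ} (hΔ : 1 ≤ Δ) (ht : 1 ≤ t)
    (hdeg : ∀ x ∈ V, #{y ∈ V | H.Adj x y} ≤ Δ)
    (hV : ∀ A ⊆ V, ∀ B ⊆ V, Disjoint A B → Small H t A ∨ Small H t B) :
    Small H (2000000 * Δ * t) V := by
  have hex : ∃ b, Small H b V := ⟨#V, Small.of_card_le le_rfl⟩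
  set b := Nat.find hex with hb
  have hbV : Small H b V := Nat.find_spec hex
  have hbmin : ∀ b', Small H b' V → b ≤ b' := fun b' h => Nat.find_min' hex h
  suffices h : b ≤ 2000000 * Δ * t from hbV.mono h
  have hbt : t ≤ 2000000 * Δ * t := Nat.le_mul_of_pos_left _ (by positivity)
  rcases Dec.small_or_exists_small_compl hV hbV subset_rfl (fun x _ y hy _ => by simp [hy])
    with h | ⟨W, hWb, hW⟩
  · exact (hbmin t h).trans hbt
  -- The weight `8 * Δ` makes a potential of at most `2 * (b * Δ)` force `4 * #Z ≤ b`.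
  have hstate : ∃ n Z f, Z ⊆ V ∧ (∀ i, Small H t {x ∈ V \ Z | f x = i}) ∧
      8 * Δ * #Z + #(cross H (V \ Z) f) = n := by
    exact ⟨_, V, 0, subset_rfl, fun i => by simpa using Small.empty, rfl⟩
  obtain ⟨Z, f, hZ, hf, hn⟩ := Nat.find_spec hstate
  set n := Nat.find hstate
  have hmin : ∀ (Z : Finset α) (f : α → ℕ), Z ⊆ V → (∀ i, Small H t {x ∈ V \ Z | f x = i}) →
      n ≤ 8 * Δ * #Z + #(cross H (V \ Z) f) := fun Z f h1 h2 =>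
    Nat.find_min' hstate ⟨Z, f, h1, h2, rfl⟩
  have hinit : n ≤ 2 * (b * Δ) := by
    obtain ⟨g, hg⟩ := Set.countable_iff_exists_injOn.1 W.countable_toSet
    -- Starting partition: `V \ W` is class `0` and `g` makes the vertices of `W` singletons, so
    -- every crossing pair has an end in `W`.
    have h1 := hmin ∅ (fun x => if x ∈ W then g x + 1 else 0) (by simp) ?_
    · refine h1.trans ?_
      simp only [card_empty, mul_zero, zero_add, sdiff_empty]
      set f₀ : α → ℕ := fun x => if x ∈ W then g x + 1 else 0
      have h2 : cross H V f₀ ⊆ {p ∈ cross H V f₀ | p.1 ∈ W} ∪ {p ∈ cross H V f₀ | p.2 ∈ W} := by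
        intro p hp
        have h3 := (mem_cross.1 hp).2.2
        by_cases hp1 : p.1 ∈ W
        · simp [hp, hp1]
        by_cases hp2 : p.2 ∈ W
        · simp [hp, hp2]
        · simp [f₀, hp1, hp2] at h3
      have h3 : #{p ∈ cross H V f₀ | p.1 ∈ W} ≤ b * Δ := by
        rw [card_cross_fst f₀ (· ∈ W)]
        calc ∑ x ∈ V with x ∈ W, #{y ∈ V | H.Adj x y ∧ f₀ x ≠ f₀ y}
            ≤ ∑ x ∈ V with x ∈ W, Δ := by
              refine sum_le_sum fun x hx => le_trans (card_le_card ?_) (hdeg x (mem_filter.1 hx).1)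
              intro y hy
              simp only [mem_filter] at hy ⊢
              exact ⟨hy.1, hy.2.1⟩
          _ = #{x ∈ V | x ∈ W} * Δ := by simp
          _ ≤ b * Δ := by
              refine Nat.mul_le_mul_right _ (le_trans (card_le_card ?_) hWb)
              intro x hx
              exact (mem_filter.1 hx).2
      have h4 := card_cross_snd (H := H) (S := V) f₀ (· ∈ W)
      have := card_le_card h2
      have := card_union_le {p ∈ cross H V f₀ | p.1 ∈ W} {p ∈ cross H V f₀ | p.2 ∈ W}
      omega
    · intro i
      rw [sdiff_empty]
      rcases Nat.eq_zero_or_pos i with rfl | hi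
      · refine hW.subset fun x hx => ?_
        simp only [mem_filter, mem_sdiff] at hx ⊢
        refine ⟨hx.1, fun hxW => ?_⟩
        simp [hxW] at hx
      · refine Small.of_card_le (le_trans (card_le_one.2 ?_) ht)
        intro x hx y hy
        simp only [mem_filter] at hx hy
        have h1 := hx.2
        have h2 := hy.2
        split_ifs at h1 h2 with hx1 hy1
        · exact hg hx1 hy1 (by omega)
        all_goals omega
  set M := #(cross H (V \ Z) f)
  -- At the minimum, the saving of `M / 3000` crossing pairs cannot exceed the price `8 * Δ` of each
  -- of the `36 * t` deletions.
  have hM : M ≤ 3000 * (8 * Δ * (36 * t)) := by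
    by_cases hM48 : 48 ≤ M
    · obtain ⟨Z', f', h1, h2, h3, h4⟩ := exists_fewer_cross hV hZ hf hM48
      have h5 := hmin Z' f' h1 h2
      have h6 := Nat.mul_le_mul_left (8 * Δ) h3
      rw [mul_add] at h6
      omega
    · have : 1 ≤ Δ * t := Nat.mul_pos hΔ ht
      nlinarith
  have hZb : 4 * #Z ≤ b := by
    have : 8 * Δ * #Z ≤ 2 * (b * Δ) := by omega
    exact Nat.le_of_mul_le_mul_left (c := 2 * Δ) (by nlinarith) (by omega)
  -- Without `Z` and the first ends of crossing pairs, no edge joins different classes, and each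
  -- class is small.
  have hfin : b ≤ t + (#Z + M) := by
    set Q := (cross H (V \ Z) f).image Prod.fst
    have h1 : Small H t ((V \ Z) \ Q) := by
      refine Small.of_classes f (fun i => (hf i).subset (filter_subset_filter _ sdiff_subset)) ?_
      intro x hx y hy hxy
      by_contra hne
      rw [mem_sdiff] at hx hy
      exact hx.2 (mem_image.2 ⟨(x, y), mem_cross.2 ⟨⟨hx.1, hy.1⟩, hxy, hne⟩, rfl⟩)
    have h2 := h1.union_card (Z ∪ Q)
    have h3 : V ⊆ (V \ Z) \ Q ∪ (Z ∪ Q) := fun x hx => by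
      simp only [mem_union, mem_sdiff]; tauto
    refine (hbmin _ (h2.subset h3)).trans (Nat.add_le_add_left ?_ _)
    exact (card_union_le _ _).trans (Nat.add_le_add_left card_image_le _)
  have : t ≤ Δ * t := Nat.le_mul_of_pos_left _ (by omega)
  nlinarith

end TreewidthSplit

/-! ### Connected and 2-connected sets: ears and the extension to a partition -/

namespace TreewidthSplit

open Finset
open scoped Classical

variable {α : Type u} {H : SimpleGraph α} {A B C S V : Finset α}

/-- The subgraph of `H` induced by `S` is connected: it is nonempty, and no proper nonempty subset
is closed under adjacency. -/
def Conn (H : SimpleGraph α) (S : Finset α) : Prop :=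
  S.Nonempty ∧ ∀ U ⊆ S, U.Nonempty → (∀ x ∈ U, ∀ y ∈ S, H.Adj x y → y ∈ U) → U = S

/-- The subgraph of `H` induced by `S` is 2-connected. -/
def TwoConn (H : SimpleGraph α) (S : Finset α) : Prop :=
  Conn H S ∧ 1 < #S ∧ ∀ x ∈ S, Conn H (S.erase x)

lemma Conn.subset_of_closed {U : Finset α} (hS : Conn H S) {T : Finset α} (hST : S ⊆ T)
    (hU : ∀ x ∈ U, ∀ y ∈ T, H.Adj x y → y ∈ U) (hne : (U ∩ S).Nonempty) : S ⊆ U := by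
  have := hS.2 (U ∩ S) inter_subset_right hne (fun x hx y hy hxy =>
    mem_inter.2 ⟨hU x (mem_inter.1 hx).1 y (hST hy) hxy, hy⟩)
  exact inter_eq_right.1 this

lemma Conn.union (hA : Conn H A) (hB : Conn H B) {a b : α} (ha : a ∈ A) (hb : b ∈ B)
    (hab : H.Adj a b) : Conn H (A ∪ B) := by
  refine ⟨hA.1.mono subset_union_left, fun U hU hne hcl => ?_⟩
  refine subset_antisymm hU ?_
  have key : A ⊆ U ∨ B ⊆ U := by
    obtain ⟨x, hx⟩ := hne
    rcases mem_union.1 (hU hx) with h | h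
    · exact .inl (hA.subset_of_closed subset_union_left hcl ⟨x, mem_inter.2 ⟨hx, h⟩⟩)
    · exact .inr (hB.subset_of_closed subset_union_right hcl ⟨x, mem_inter.2 ⟨hx, h⟩⟩)
  rcases key with h | h
  · refine union_subset h (hB.subset_of_closed subset_union_right hcl ⟨b, mem_inter.2 ⟨?_, hb⟩⟩)
    exact hcl a (h ha) b (mem_union_right _ hb) hab
  · refine union_subset (hA.subset_of_closed subset_union_left hcl ⟨a, mem_inter.2 ⟨?_, ha⟩⟩) h
    exact hcl b (h hb) a (mem_union_left _ ha) hab.symm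

lemma Conn.singleton (x : α) : Conn H {x} :=
  ⟨singleton_nonempty x, fun _ hU hne _ => (subset_singleton_iff.1 hU).resolve_left hne.ne_empty⟩

/-- A disconnected nonempty set splits into two nonempty nonadjacent parts. -/
lemma exists_split_of_not_conn (hne : S.Nonempty) (h : ¬ Conn H S) :
    ∃ U ⊆ S, U.Nonempty ∧ (S \ U).Nonempty ∧ ∀ x ∈ U, ∀ y ∈ S \ U, ¬ H.Adj x y := by
  simp only [Conn, not_and, not_forall] at h
  obtain ⟨U, hU, hUne, hcl, hne'⟩ := h hne
  refine ⟨U, hU, hUne, ?_, fun x hx y hy hxy => ?_⟩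
  · rw [sdiff_nonempty]
    exact fun h => hne' (subset_antisymm hU h)
  · rw [mem_sdiff] at hy
    exact hy.2 (hcl x hx y hy.1 hxy)

/-- A connected set with two neighbours in a 2-connected set contains the interior of an ear. -/
lemma TwoConn.exists_ear (hB : TwoConn H B) (hC : Conn H C) (hd : Disjoint B C)
    {b₁ b₂ c₁ c₂ : α} (hb : b₁ ≠ b₂) (hb₁ : b₁ ∈ B) (hb₂ : b₂ ∈ B) (hc₁ : c₁ ∈ C) (hc₂ : c₂ ∈ C)
    (h₁ : H.Adj c₁ b₁) (h₂ : H.Adj c₂ b₂) :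
    ∃ P ⊆ C, P.Nonempty ∧ TwoConn H (B ∪ P) := by
  -- A smallest connected set attached to both `b₁` and `b₂` plays the role of the interior of the
  -- ear; no explicit path is needed.
  have hex : ∃ n, ∃ P ⊆ C, Conn H P ∧ (∃ c ∈ P, H.Adj c b₁) ∧ (∃ c ∈ P, H.Adj c b₂) ∧ #P = n :=
    ⟨_, C, subset_rfl, hC, ⟨c₁, hc₁, h₁⟩, ⟨c₂, hc₂, h₂⟩, rfl⟩
  obtain ⟨P, hPC, hP, ⟨c₁, hc₁, h₁⟩, ⟨c₂, hc₂, h₂⟩, hPn⟩ := Nat.find_spec hex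
  have hmin : ∀ Q ⊆ P, Conn H Q → (∃ c ∈ Q, H.Adj c b₁) → (∃ c ∈ Q, H.Adj c b₂) → #P ≤ #Q := by
    intro Q hQ h1 h2 h3
    rw [hPn]
    exact Nat.find_min' hex ⟨Q, hQ.trans hPC, h1, h2, h3, rfl⟩
  have hBP : Disjoint B P := hd.mono_right hPC
  -- a part of `P - x` that sees neither `B` nor the rest of `P - x` is empty
  have key : ∀ x ∈ P, ∀ Q ⊆ P, x ∉ Q → (∀ z ∈ Q, ∀ y ∈ B, ¬ H.Adj z y) →
      (∀ z ∈ Q, ∀ y ∈ P, y ≠ x → H.Adj z y → y ∈ Q) → Q = ∅ := by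
    intro x hx Q hQ hxQ hQB hQcl
    have hconn : Conn H (P \ Q) := by
      refine ⟨⟨x, mem_sdiff.2 ⟨hx, hxQ⟩⟩, fun U hU hne hcl => ?_⟩
      -- A closed part of `P \ Q` missing `x` would be closed in `P`, since `Q` meets the rest of
      -- `P` only through `x`. So two complementary closed parts would both contain `x`.
      have hbig : ∀ U ⊆ P \ Q, U.Nonempty →
          (∀ z ∈ U, ∀ y ∈ P \ Q, H.Adj z y → y ∈ U) → x ∈ U := by
        intro U hU hne hcl
        by_contra hxU
        have := hP.2 U (hU.trans sdiff_subset) hne (fun z hz y hy hzy => by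
          refine hcl z hz y (mem_sdiff.2 ⟨hy, fun hyQ => ?_⟩) hzy
          have h1 := mem_sdiff.1 (hU hz)
          exact h1.2 (hQcl y hyQ z h1.1 (fun h => hxU (h ▸ hz)) hzy.symm))
        exact hxU (this ▸ hx)
      by_contra hUne
      have h1 := hbig U hU hne hcl
      have h2 := hbig ((P \ Q) \ U) sdiff_subset
        (sdiff_nonempty.2 fun h => hUne (subset_antisymm hU h)) (fun z hz y hy hzy => by
          rw [mem_sdiff] at hz ⊢
          exact ⟨hy, fun hyU => hz.2 (hcl y hyU z hz.1 hzy.symm)⟩)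
      exact (mem_sdiff.1 h2).2 h1
    have := hmin (P \ Q) sdiff_subset hconn
      ⟨c₁, mem_sdiff.2 ⟨hc₁, fun h => hQB c₁ h b₁ hb₁ h₁⟩, h₁⟩
      ⟨c₂, mem_sdiff.2 ⟨hc₂, fun h => hQB c₂ h b₂ hb₂ h₂⟩, h₂⟩
    rw [card_sdiff_of_subset hQ] at this
    have := card_le_card hQ
    have := card_pos.2 ⟨x, hx⟩
    exact card_eq_zero.1 (by omega)
  refine ⟨P, hPC, hP.1, hB.1.union hP hb₁ hc₁ h₁.symm,
    hB.2.1.trans_le (card_le_card subset_union_left), fun x hx => ?_⟩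
  by_cases hxB : x ∈ B
  · have hxP : x ∉ P := disjoint_left.1 hBP hxB
    rw [erase_union_distrib, erase_eq_of_notMem hxP]
    by_cases hx1 : x = b₁
    · exact (hB.2.2 x hxB).union hP (mem_erase.2 ⟨fun h => hb (hx1.symm.trans h.symm), hb₂⟩) hc₂
        h₂.symm
    · exact (hB.2.2 x hxB).union hP (mem_erase.2 ⟨Ne.symm hx1, hb₁⟩) hc₁ h₁.symm
  · have hxP : x ∈ P := (mem_union.1 hx).resolve_left hxB
    rw [erase_union_distrib, erase_eq_of_notMem hxB]
    refine ⟨hB.1.1.mono subset_union_left, fun U hU hne hcl => ?_⟩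
    have hUP : ∀ z ∈ U, z ∉ B → z ∈ P ∧ z ≠ x := fun z hz hzB => by
      have := (mem_union.1 (hU hz)).resolve_left hzB
      rw [mem_erase] at this
      exact this.symm
    by_cases hUB : (U ∩ B).Nonempty
    · have hBU := hB.1.subset_of_closed subset_union_left hcl hUB
      -- Whatever of `P - x` is not reached from `B` sees neither `B` nor the reached part, hence is
      -- empty.
      have h0 := key x hxP (P.erase x \ U) (sdiff_subset.trans (erase_subset _ _)) (by simp)
        (fun z hz y hy hzy => by
          rw [mem_sdiff] at hz
          exact hz.2 (hcl y (hBU hy) z (mem_union_right _ hz.1) hzy.symm))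
        (fun z hz y hy hyx hzy => by
          rw [mem_sdiff] at hz ⊢
          exact ⟨mem_erase.2 ⟨hyx, hy⟩,
            fun hyU => hz.2 (hcl y hyU z (mem_union_right _ hz.1) hzy.symm)⟩)
      exact subset_antisymm hU (union_subset hBU (sdiff_eq_empty_iff_subset.1 h0))
    · exfalso
      have hUB' : ∀ z ∈ U, z ∉ B := fun z hz hzB => hUB ⟨z, mem_inter.2 ⟨hz, hzB⟩⟩
      have h0 := key x hxP U (fun z hz => (hUP z hz (hUB' z hz)).1)
        (fun h => (hUP x h (hUB' x h)).2 rfl)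
        (fun z hz y hy hzy => hUB' y (hcl z hz y (mem_union_left _ hy) hzy) hy)
        (fun z hz y hy hyx hzy => hcl z hz y (mem_union_right _ (mem_erase.2 ⟨hyx, hy⟩)) hzy)
      exact hne.ne_empty h0

/-- In a 2-connected graph, a disjoint pair of a connected and a 2-connected set extends to a
partition of the vertex set into a connected and a 2-connected set. -/
theorem TwoConn.exists_partition (hV : TwoConn H V) (hA : Conn H A) (hB : TwoConn H B)
    (hAV : A ⊆ V) (hBV : B ⊆ V) (hd : Disjoint A B) :
    ∃ A' B', A ⊆ A' ∧ B ⊆ B' ∧ A' ∪ B' = V ∧ Disjoint A' B' ∧ Conn H A' ∧ TwoConn H B' := by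
  -- Take an extension leaving as few vertices uncovered as possible.
  have hex : ∃ n, ∃ A' B', A ⊆ A' ∧ B ⊆ B' ∧ A' ⊆ V ∧ B' ⊆ V ∧ Disjoint A' B' ∧ Conn H A' ∧
      TwoConn H B' ∧ #(V \ (A' ∪ B')) = n :=
    ⟨_, A, B, subset_rfl, subset_rfl, hAV, hBV, hd, hA, hB, rfl⟩
  obtain ⟨A', B', h1, h2, h3, h4, h5, h6, h7, h8⟩ := Nat.find_spec hex
  have hmin : ∀ A'' B'', A ⊆ A'' → B ⊆ B'' → A'' ⊆ V → B'' ⊆ V → Disjoint A'' B'' → Conn H A'' →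
      TwoConn H B'' → #(V \ (A' ∪ B')) ≤ #(V \ (A'' ∪ B'')) :=
    fun A'' B'' g1 g2 g3 g4 g5 g6 g7 => h8 ▸
      Nat.find_min' hex ⟨A'', B'', g1, g2, g3, g4, g5, g6, g7, rfl⟩
  refine ⟨A', B', h1, h2, subset_antisymm (union_subset h3 h4) ?_, h5, h6, h7⟩
  by_contra hsub
  set R := V \ (A' ∪ B') with hR
  have hlt : ∀ A'' B'', A' ∪ B' ⊆ A'' ∪ B'' → (∃ x ∈ R, x ∈ A'' ∪ B'') →
      #(V \ (A'' ∪ B'')) < #R := by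
    rintro A'' B'' hss ⟨x, hx, hx'⟩
    refine card_lt_card (Finset.ssubset_iff_subset_ne.2 ⟨sdiff_subset_sdiff subset_rfl hss, fun h => ?_⟩)
    rw [← h] at hx
    exact (mem_sdiff.1 hx).2 hx'
  have hRA : ∀ x ∈ R, ∀ a ∈ A', ¬ H.Adj x a := by
    intro x hx a ha hxa
    have hx' := mem_sdiff.1 hx
    rw [mem_union, not_or] at hx'
    have g1 := hmin (A' ∪ {x}) B' (h1.trans subset_union_left) h2
      (union_subset h3 (singleton_subset_iff.2 hx'.1)) h4
      (disjoint_union_left.2 ⟨h5, disjoint_singleton_left.2 hx'.2.2⟩)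
      (h6.union (Conn.singleton x) ha (mem_singleton_self x) hxa.symm) h7
    have g2 := hlt (A' ∪ {x}) B' (union_subset_union subset_union_left subset_rfl)
      ⟨x, hx, by simp⟩
    omega
  -- A smallest nonempty closed subset of the uncovered set is one of its components.
  have hexC : ∃ n, ∃ C ⊆ R, C.Nonempty ∧ (∀ x ∈ C, ∀ y ∈ R, H.Adj x y → y ∈ C) ∧ #C = n :=
    ⟨_, R, subset_rfl, sdiff_nonempty.2 hsub, fun _ _ y hy _ => hy, rfl⟩
  obtain ⟨C, hCR, hCne, hCcl, hCn⟩ := Nat.find_spec hexC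
  have hC : Conn H C := by
    refine ⟨hCne, fun U hU hUne hUcl => eq_of_subset_of_card_le hU ?_⟩
    rw [hCn]
    exact Nat.find_min' hexC ⟨U, hU.trans hCR, hUne,
      fun x hx y hy hxy => hUcl x hx y (hCcl x (hU hx) y hy hxy) hxy, rfl⟩
  have hCV : C ⊆ V := hCR.trans sdiff_subset
  have hCA : Disjoint C A' := disjoint_left.2 fun x hx hxA =>
    (mem_sdiff.1 (hCR hx)).2 (mem_union_left _ hxA)
  have hCB : Disjoint B' C := disjoint_left.2 fun x hxB hx =>
    (mem_sdiff.1 (hCR hx)).2 (mem_union_right _ hxB)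
  -- Since `C` sees neither `A'` nor the rest of `R`, attachment to `b` alone would make `b`
  -- separate `C` from the nonempty `A'`. Applied twice, this gives two distinct attachments.
  have hout : ∀ b ∈ B', ∃ b' ∈ B', b' ≠ b ∧ ∃ c ∈ C, H.Adj c b' := by
    intro b hb
    by_contra! hno
    have hconn := hV.2.2 b (h4 hb)
    have hsub : C ⊆ V.erase b := fun x hx =>
      mem_erase.2 ⟨fun h => disjoint_left.1 hCB hb (h ▸ hx), hCV hx⟩
    have := hconn.2 C hsub hCne (fun x hx y hy hxy => by
      rw [mem_erase] at hy
      by_cases hyB : y ∈ B'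
      · exact absurd hxy (hno y hyB hy.1 x hx)
      by_cases hyA : y ∈ A'
      · exact absurd hxy (hRA x (hCR hx) y hyA)
      · exact hCcl x hx y (mem_sdiff.2 ⟨hy.2, by simp [hyA, hyB]⟩) hxy)
    obtain ⟨a, ha⟩ := h6.1
    have haC : a ∈ C := this ▸ mem_erase.2 ⟨fun h => disjoint_left.1 h5 ha (h ▸ hb), h3 ha⟩
    exact disjoint_left.1 hCA haC ha
  obtain ⟨b₀, hb₀⟩ := h7.1.1
  obtain ⟨b₁, hb₁, -, c₁, hc₁, hcb₁⟩ := hout b₀ hb₀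
  obtain ⟨b₂, hb₂, hne, c₂, hc₂, hcb₂⟩ := hout b₁ hb₁
  obtain ⟨P, hPC, ⟨p, hp⟩, hBP⟩ := h7.exists_ear hC hCB hne.symm hb₁ hb₂ hc₁ hc₂ hcb₁ hcb₂
  have g1 := hmin A' (B' ∪ P) h1 (h2.trans subset_union_left) h3
    (union_subset h4 (hPC.trans hCV))
    (disjoint_union_right.2 ⟨h5, (hCA.mono_left hPC).symm⟩) h6 hBP
  have g2 := hlt A' (B' ∪ P) (union_subset_union subset_rfl subset_union_left)
    ⟨p, hCR (hPC hp), by simp [hp]⟩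
  omega

/-! ### Minimal sets that are not small -/

variable {t : ℕ}

/-- A set which is not small contains a minimal such set. -/
lemma exists_minimal_not_small (h : ¬ Small H t S) :
    ∃ T ⊆ S, ¬ Small H t T ∧ ∀ U ⊆ T, U ≠ T → Small H t U := by
  have hex : ∃ n, ∃ T ⊆ S, ¬ Small H t T ∧ #T = n := ⟨_, S, subset_rfl, h, rfl⟩
  obtain ⟨T, hT, hTn, hn⟩ := Nat.find_spec hex
  refine ⟨T, hT, hTn, fun U hU hne => ?_⟩
  by_contra hUn
  have := Nat.find_min' hex ⟨U, hU.trans hT, hUn, rfl⟩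
  exact hne (eq_of_subset_of_card_le hU (by omega))

/-- Two nonadjacent proper parts would be small by minimality, and so would their union. -/
lemma conn_of_minimal_not_small (h : ¬ Small H t S) (hmin : ∀ U ⊆ S, U ≠ S → Small H t U) :
    Conn H S := by
  by_contra hc
  have hne : S.Nonempty := by
    rw [nonempty_iff_ne_empty]; rintro rfl; exact h Small.empty
  obtain ⟨U, hU, ⟨x, hx⟩, ⟨y, hy⟩, hn⟩ := exists_split_of_not_conn hne hc
  refine h ?_
  have := (hmin U hU (fun e => by rw [e] at hy; simp at hy)).union
    (hmin (S \ U) sdiff_subset (fun e => by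
      have := hU hx; rw [← e] at this; exact (mem_sdiff.1 this).2 hx)) disjoint_sdiff hn
  rwa [union_sdiff_of_subset hU] at this

/-- A minimal non-small set is 2-connected, provided decompositions can be re-rooted. -/
lemma twoConn_of_minimal_not_small (ht : 1 ≤ t)
    (hroot : ∀ S : Finset α, ∀ x ∈ S, Small H t S → Dec H t {x} (S.erase x))
    (h : ¬ Small H t S) (hmin : ∀ U ⊆ S, U ≠ S → Small H t U) : TwoConn H S := by
  have hcard : 1 < #S := by
    by_contra hc
    exact h (Small.of_card_le (by omega))
  refine ⟨conn_of_minimal_not_small h hmin, hcard, fun x hx => ?_⟩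
  by_contra hc
  have hne : (S.erase x).Nonempty := by
    rw [← card_pos, card_erase_of_mem hx]; omega
  obtain ⟨U, hU, ⟨a, ha⟩, ⟨b, hb⟩, hn⟩ := exists_split_of_not_conn hne hc
  -- Each side of the cut vertex `x`, together with `x`, is a proper subset and so small. Re-rooted
  -- at `{x}`, the two decompositions combine into one of `S`.
  have aux : ∀ U ⊆ S.erase x, ((S.erase x) \ U).Nonempty → Dec H t {x} U := by
    rintro U hU ⟨b, hb⟩
    have hxU : x ∉ U := fun h => by simpa using hU h
    have h1 := hroot (insert x U) x (mem_insert_self _ _) (hmin _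
      (insert_subset hx (hU.trans (erase_subset _ _))) (fun e => by
        have hb' := mem_sdiff.1 hb
        have : b ∈ insert x U := e ▸ (mem_of_mem_erase hb'.1)
        rw [mem_insert] at this
        exact this.elim (ne_of_mem_erase hb'.1) hb'.2))
    rwa [erase_insert hxU] at h1
  have h1 := Dec.union {x} _ _ (aux U hU ⟨b, hb⟩)
    (aux ((S.erase x) \ U) sdiff_subset ⟨a, by simpa [ha] using hU ha⟩) disjoint_sdiff hn
  rw [union_sdiff_of_subset hU] at h1
  have h2 := Dec.step ∅ {x} _ (by simp) h1 (by simp) (by simp)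
  rw [sdiff_empty, ← insert_eq, insert_erase hx] at h2
  exact h h2

end TreewidthSplit

/-! ### Rooted decompositions versus tree decompositions -/

namespace TreewidthSplit

open Finset
open scoped Classical

variable {α : Type u} {H : SimpleGraph α} {b : ℕ} {S S₁ S₂ X C : Finset α}

/-- `Chain T bag x s t`: the nodes `s` and `t` are joined in `T` inside the set of nodes whose bag
contains `x`. -/
def Chain {ι : Type*} (T : SimpleGraph ι) (bag : ι → Finset α) (x : α) : ι → ι → Prop :=
  Relation.ReflTransGen fun s t => T.Adj s t ∧ x ∈ bag s ∧ x ∈ bag t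

lemma Chain.symm {ι : Type*} {T : SimpleGraph ι} {bag : ι → Finset α} {x : α} {s t : ι}
    (h : Chain T bag x s t) : Chain T bag x t s := by
  induction h with
  | refl => exact .refl
  | tail _ h ih => exact .head ⟨h.1.symm, h.2.2, h.2.1⟩ ih

/-- Deleting an edge `rs` of a forest: a chain that starts on the side of `r` either stays there
or passes through `r` and `s`. -/
lemma Chain.of_delete {ι : Type*} {F F' : SimpleGraph ι} {bag : ι → Finset α} {r s : ι}
    (hadj : ∀ a b, F.Adj a b → F'.Adj a b ∨ (a = r ∧ b = s) ∨ (a = s ∧ b = r))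
    (hrs : ¬ F'.Reachable r s) {x : α} {t u : ι} (ht : F'.Reachable r t)
    (h : Chain F bag x t u) :
    (F'.Reachable r u ∧ Chain F' bag x t u) ∨
      (F'.Reachable s u ∧ Chain F' bag x t r ∧ x ∈ bag r ∧ x ∈ bag s) := by
  induction h with
  | refl => exact .inl ⟨ht, .refl⟩
  | @tail u v _ h ih =>
    obtain ⟨huv, hu, hv⟩ := h
    rcases hadj u v huv with h1 | ⟨rfl, rfl⟩ | ⟨rfl, rfl⟩
    · rcases ih with ⟨h2, h3⟩ | ⟨h2, h3⟩
      · exact .inl ⟨h2.trans h1.reachable, h3.tail ⟨h1, hu, hv⟩⟩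
      · exact .inr ⟨h2.trans h1.reachable, h3⟩
    · rcases ih with ⟨h2, h3⟩ | ⟨h2, h3⟩
      · exact .inr ⟨.refl _, h3, hu, hv⟩
      · exact .inr ⟨.refl _, h3⟩
    · rcases ih with ⟨h2, h3⟩ | ⟨h2, h3⟩
      · exact absurd h2 hrs
      · exact .inl ⟨.refl _, h3.1⟩

/-- The component of `r` in a forest of bags gives a rooted decomposition with root bag `bag r`. -/
lemma dec_of_forest {ι : Type*} [Finite ι] (bag : ι → Finset α) (hb : ∀ t, #(bag t) ≤ b) :
    ∀ (n : ℕ) (F : SimpleGraph ι), F.edgeSet.ncard = n → F.IsAcyclic → ∀ (r : ι) (S : Finset α),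
      (∀ x s t, F.Reachable r s → F.Reachable r t → x ∈ bag s → x ∈ bag t → Chain F bag x s t) →
      (∀ x ∈ S, ∀ y ∈ S, H.Adj x y → ∃ s, F.Reachable r s ∧ x ∈ bag s ∧ y ∈ bag s) →
      (∀ x, x ∈ S ↔ ∃ s, F.Reachable r s ∧ x ∈ bag s) → Dec H b (bag r) (S \ bag r) := by
  intro n
  induction n using Nat.strong_induction_on with
  | _ n ih =>
  intro F hn hF r S hconn hedge hS
  by_cases hr : ∃ s, F.Adj r s
  swap
  · push Not at hr
    have : S \ bag r = ∅ := by
      rw [sdiff_eq_empty_iff_subset]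
      intro x hx
      obtain ⟨s, ⟨p⟩, hxs⟩ := (hS x).1 hx
      cases p with
      | nil => exact hxs
      | cons h _ => exact absurd h (hr _)
    rw [this]
    exact .nil _ (hb r)
  obtain ⟨s, hrs⟩ := hr
  -- Induction step: cutting a root edge leaves the trees of `r` and `s`, whose vertex sets share
  -- only vertices lying in both `bag r` and `bag s`. The second tree is hung below `bag r` by
  -- `Dec.step` and joined to the first by `Dec.union`.
  set F' := F.deleteEdges {s(r, s)} with hF'
  have hle : F' ≤ F := F.deleteEdges_le _
  have hbr : ¬ F'.Reachable r s :=
    SimpleGraph.isBridge_iff.1 (SimpleGraph.isAcyclic_iff_forall_adj_isBridge.1 hF hrs)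
  have hadj : ∀ a b, F.Adj a b → F'.Adj a b ∨ (a = r ∧ b = s) ∨ (a = s ∧ b = r) := by
    intro a b hab
    by_cases h : s(a, b) = s(r, s)
    · exact .inr (by simpa using h)
    · refine .inl ?_
      rw [hF', SimpleGraph.deleteEdges_adj]
      exact ⟨hab, by simpa using h⟩
  have hadj' : ∀ a b, F.Adj a b → F'.Adj a b ∨ (a = s ∧ b = r) ∨ (a = r ∧ b = s) :=
    fun a b h => (hadj a b h).imp id Or.symm
  have hbr' : ¬ F'.Reachable s r := fun h => hbr h.symm
  have hacyc : F'.IsAcyclic := hF.anti hle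
  have hcard : F'.edgeSet.ncard < n := by
    rw [← hn]
    refine Set.ncard_lt_ncard ?_ (Set.toFinite _)
    refine ⟨SimpleGraph.edgeSet_mono hle, fun h => ?_⟩
    have : s(r, s) ∈ F'.edgeSet := h hrs
    exact hbr (SimpleGraph.Adj.reachable this)
  have hcomp : ∀ u, F.Reachable r u → F'.Reachable r u ∨ F'.Reachable s u := by
    intro u hu
    rw [SimpleGraph.reachable_iff_reflTransGen] at hu
    induction hu with
    | refl => exact .inl (.refl _)
    | @tail u v _ huv ih =>
      rcases hadj u v huv with h1 | ⟨rfl, rfl⟩ | ⟨rfl, rfl⟩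
      · exact ih.imp (fun h => h.trans h1.reachable) (fun h => h.trans h1.reachable)
      · exact .inr (.refl _)
      · exact .inl (.refl _)
  have hr1 : ∀ u, F'.Reachable r u → F.Reachable r u := fun u h => h.mono hle
  have hs1 : ∀ u, F'.Reachable s u → F.Reachable r u := fun u h =>
    hrs.reachable.trans (h.mono hle)
  have hboth : ∀ x u v, F'.Reachable r u → F'.Reachable s v → x ∈ bag u → x ∈ bag v →
      x ∈ bag r ∧ x ∈ bag s := by
    intro x u v hu hv hxu hxv
    rcases (hconn x u v (hr1 u hu) (hs1 v hv) hxu hxv).of_delete hadj hbr hu with h | h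
    · exact absurd (h.1.trans hv.symm) hbr
    · exact h.2.2
  set S₁ := {x ∈ S | ∃ u, F'.Reachable r u ∧ x ∈ bag u} with hS₁
  set S₂ := {x ∈ S | ∃ u, F'.Reachable s u ∧ x ∈ bag u} with hS₂
  have m₁ : ∀ x, x ∈ S₁ ↔ ∃ u, F'.Reachable r u ∧ x ∈ bag u := by
    intro x
    simp only [hS₁, mem_filter, and_iff_right_iff_imp]
    rintro ⟨u, hu, hx⟩
    exact (hS x).2 ⟨u, hr1 u hu, hx⟩
  have m₂ : ∀ x, x ∈ S₂ ↔ ∃ u, F'.Reachable s u ∧ x ∈ bag u := by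
    intro x
    simp only [hS₂, mem_filter, and_iff_right_iff_imp]
    rintro ⟨u, hu, hx⟩
    exact (hS x).2 ⟨u, hs1 u hu, hx⟩
  have hS12 : ∀ x, x ∈ S₁ → x ∈ S₂ → x ∈ bag r ∧ x ∈ bag s := by
    intro x h1 h2
    obtain ⟨u, hu, hxu⟩ := (m₁ x).1 h1
    obtain ⟨v, hv, hxv⟩ := (m₂ x).1 h2
    exact hboth x u v hu hv hxu hxv
  have hrS : ∀ x ∈ bag r, x ∈ S₁ := fun x hx => (m₁ x).2 ⟨r, .refl _, hx⟩
  have hsS : ∀ x ∈ bag s, x ∈ S₂ := fun x hx => (m₂ x).2 ⟨s, .refl _, hx⟩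
  have hSS : ∀ x, x ∈ S ↔ x ∈ S₁ ∨ x ∈ S₂ := by
    intro x
    constructor
    · intro hx
      obtain ⟨u, hu, hxu⟩ := (hS x).1 hx
      exact (hcomp u hu).imp (fun h => (m₁ x).2 ⟨u, h, hxu⟩) (fun h => (m₂ x).2 ⟨u, h, hxu⟩)
    · rintro (h | h)
      · exact (mem_filter.1 h).1
      · exact (mem_filter.1 h).1
  have hsplit : ∀ x ∈ S, ∀ y ∈ S, H.Adj x y → (x ∈ S₁ ∧ y ∈ S₁) ∨ (x ∈ S₂ ∧ y ∈ S₂) := by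
    intro x hx y hy hxy
    obtain ⟨u, hu, hxu, hyu⟩ := hedge x hx y hy hxy
    exact (hcomp u hu).imp (fun h => ⟨(m₁ x).2 ⟨u, h, hxu⟩, (m₁ y).2 ⟨u, h, hyu⟩⟩)
      (fun h => ⟨(m₂ x).2 ⟨u, h, hxu⟩, (m₂ y).2 ⟨u, h, hyu⟩⟩)
  have d₁ : Dec H b (bag r) (S₁ \ bag r) := by
    refine ih _ hcard F' rfl hacyc r S₁ ?_ ?_ m₁
    · intro x u v hu hv hxu hxv
      rcases (hconn x u v (hr1 u hu) (hr1 v hv) hxu hxv).of_delete hadj hbr hu with h | h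
      · exact h.2
      · exact absurd (hv.trans h.1.symm) hbr
    · intro x hx y hy hxy
      obtain ⟨u, hu, hxu, hyu⟩ := hedge x ((hSS x).2 (.inl hx)) y ((hSS y).2 (.inl hy)) hxy
      rcases hcomp u hu with h | h
      · exact ⟨u, h, hxu, hyu⟩
      -- An edge witnessed only on the side of `s` but with both ends in `S₁` has both ends in `bag
      -- r`.
      · exact ⟨r, .refl _, (hS12 x hx ((m₂ x).2 ⟨u, h, hxu⟩)).1,
          (hS12 y hy ((m₂ y).2 ⟨u, h, hyu⟩)).1⟩
  have d₂ : Dec H b (bag s) (S₂ \ bag s) := by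
    refine ih _ hcard F' rfl hacyc s S₂ ?_ ?_ m₂
    · intro x u v hu hv hxu hxv
      rcases (hconn x u v (hs1 u hu) (hs1 v hv) hxu hxv).of_delete hadj' hbr' hu with h | h
      · exact h.2
      · exact absurd (hv.trans h.1.symm) hbr'
    · intro x hx y hy hxy
      obtain ⟨u, hu, hxu, hyu⟩ := hedge x ((hSS x).2 (.inr hx)) y ((hSS y).2 (.inr hy)) hxy
      rcases hcomp u hu with h | h
      · exact ⟨s, .refl _, (hS12 x ((m₁ x).2 ⟨u, h, hxu⟩) hx).2,
          (hS12 y ((m₁ y).2 ⟨u, h, hyu⟩) hy).2⟩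
      · exact ⟨u, h, hxu, hyu⟩
  have e₂ : (bag s \ bag r) ∪ (S₂ \ bag s) = S₂ \ bag r := by
    ext x
    simp only [mem_union, mem_sdiff]
    constructor
    · rintro (h | h)
      · exact ⟨hsS x h.1, h.2⟩
      · exact ⟨h.1, fun h' => h.2 (hS12 x (hrS x h') h.1).2⟩
    · tauto
  have d₂' : Dec H b (bag r) (S₂ \ bag r) := by
    rw [← e₂]
    refine .step _ _ _ (hb r) d₂ ?_ ?_
    · rw [disjoint_left]
      intro x hx hx2
      rw [mem_sdiff] at hx2
      exact hx2.2 (hS12 x (hrS x hx) hx2.1).2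
    · rw [e₂]
      intro x hx y hy hxy
      rw [mem_sdiff] at hx hy
      rcases hsplit x ((hSS x).2 (.inr hx.1)) y ((hSS y).2 (.inl (hrS y hy.1))) hxy with h | h
      · exact hx.2 (hS12 x h.1 hx.1).1
      · exact hy.2 (hS12 y (hrS y hy.1) h.2).2
  have e : S \ bag r = (S₁ \ bag r) ∪ (S₂ \ bag r) := by
    ext x
    simp only [mem_union, mem_sdiff, hSS]; tauto
  rw [e]
  refine .union _ _ _ d₁ d₂' ?_ ?_
  · rw [disjoint_left]
    intro x h1 h2
    rw [mem_sdiff] at h1 h2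
    exact h1.2 (hS12 x h1.1 h2.1).1
  · intro x hx y hy hxy
    rw [mem_sdiff] at hx hy
    rcases hsplit x ((hSS x).2 (.inl hx.1)) y ((hSS y).2 (.inr hy.1)) hxy with h | h
    · exact hy.2 (hS12 y h.2 hy.1).1
    · exact hx.2 (hS12 x hx.1 h.1).1

/-- The bags `bag` on the tree `T` form a tree decomposition of the subgraph of `H` induced
by `S`. -/
structure IsTreeDec {ι : Type*} (H : SimpleGraph α) (S : Finset α) (T : SimpleGraph ι)
    (bag : ι → Finset α) : Prop where
  isTree : T.IsTree
  bag_subset : ∀ t, bag t ⊆ S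
  exists_mem : ∀ x ∈ S, ∃ t, x ∈ bag t
  exists_edge : ∀ x ∈ S, ∀ y ∈ S, H.Adj x y → ∃ t, x ∈ bag t ∧ y ∈ bag t
  chain : ∀ x s t, x ∈ bag s → x ∈ bag t → Chain T bag x s t

lemma IsTreeDec.dec {ι : Type*} [Finite ι] {T : SimpleGraph ι} {bag : ι → Finset α}
    (h : IsTreeDec H S T bag) (hb : ∀ t, #(bag t) ≤ b) (r : ι) :
    Dec H b (bag r) (S \ bag r) := by
  have hr : ∀ t, T.Reachable r t := fun t => h.isTree.1.preconnected r t
  refine dec_of_forest bag hb _ T rfl h.isTree.2 r S ?_ ?_ ?_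
  · exact fun x s t _ _ => h.chain x s t
  · intro x hx y hy hxy
    obtain ⟨t, ht⟩ := h.exists_edge x hx y hy hxy
    exact ⟨t, hr t, ht⟩
  · intro x
    exact ⟨fun hx => (h.exists_mem x hx).imp fun t ht => ⟨hr t, ht⟩,
      fun ⟨t, _, ht⟩ => h.bag_subset t ht⟩

/-- Reachability in a disjoint union never changes sides, so each edge remains a bridge. -/
lemma isAcyclic_sum {ι₁ ι₂ : Type*} {T₁ : SimpleGraph ι₁} {T₂ : SimpleGraph ι₂}
    (h₁ : T₁.IsAcyclic) (h₂ : T₂.IsAcyclic) : (T₁.sum T₂).IsAcyclic := by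
  rw [SimpleGraph.isAcyclic_iff_forall_adj_isBridge] at *
  rintro (a | a) (b | b) hab
  · have hadj : T₁.Adj a b := by simpa using hab
    rw [SimpleGraph.isBridge_iff, SimpleGraph.reachable_iff_reflTransGen]
    intro hreach
    have key : ∀ z, Relation.ReflTransGen
        ((T₁.sum T₂).deleteEdges {s(Sum.inl a, Sum.inl b)}).Adj (Sum.inl a) z →
        ∃ u, z = Sum.inl u ∧ (T₁.deleteEdges {s(a, b)}).Reachable a u := by
      intro z hz
      induction hz with
      | refl => exact ⟨a, rfl, .refl _⟩
      | @tail y z _ hyz ih =>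
        obtain ⟨u, rfl, hu⟩ := ih
        rcases z with z | z
        · refine ⟨z, rfl, hu.trans (SimpleGraph.Adj.reachable ?_)⟩
          simpa [SimpleGraph.deleteEdges_adj] using hyz
        · simp [SimpleGraph.deleteEdges_adj] at hyz
    obtain ⟨u, hu, hau⟩ := key _ hreach
    obtain rfl := Sum.inl_injective hu
    exact SimpleGraph.isBridge_iff.1 (h₁ hadj) hau
  · simp at hab
  · simp at hab
  · have hadj : T₂.Adj a b := by simpa using hab
    rw [SimpleGraph.isBridge_iff, SimpleGraph.reachable_iff_reflTransGen]
    intro hreach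
    have key : ∀ z, Relation.ReflTransGen
        ((T₁.sum T₂).deleteEdges {s(Sum.inr a, Sum.inr b)}).Adj (Sum.inr a) z →
        ∃ u, z = Sum.inr u ∧ (T₂.deleteEdges {s(a, b)}).Reachable a u := by
      intro z hz
      induction hz with
      | refl => exact ⟨a, rfl, .refl _⟩
      | @tail y z _ hyz ih =>
        obtain ⟨u, rfl, hu⟩ := ih
        rcases z with z | z
        · simp [SimpleGraph.deleteEdges_adj] at hyz
        · refine ⟨z, rfl, hu.trans (SimpleGraph.Adj.reachable ?_)⟩
          simpa [SimpleGraph.deleteEdges_adj] using hyz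
    obtain ⟨u, hu, hau⟩ := key _ hreach
    obtain rfl := Sum.inr_injective hu
    exact SimpleGraph.isBridge_iff.1 (h₂ hadj) hau

/-- Two tree decompositions can be joined by an edge between nodes whose bags contain the common
vertices. -/
lemma IsTreeDec.join {ι₁ ι₂ : Type*} {T₁ : SimpleGraph ι₁} {T₂ : SimpleGraph ι₂}
    {bag₁ : ι₁ → Finset α} {bag₂ : ι₂ → Finset α} (h₁ : IsTreeDec H S₁ T₁ bag₁)
    (h₂ : IsTreeDec H S₂ T₂ bag₂) (r₁ : ι₁) (r₂ : ι₂)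
    (hr : ∀ x ∈ S₁, x ∈ S₂ → x ∈ bag₁ r₁ ∧ x ∈ bag₂ r₂)
    (hn : ∀ x ∈ S₁, x ∉ S₂ → ∀ y ∈ S₂, y ∉ S₁ → ¬ H.Adj x y) :
    IsTreeDec H (S₁ ∪ S₂) (T₁.sum T₂ ⊔ SimpleGraph.edge (.inl r₁) (.inr r₂))
      (Sum.elim bag₁ bag₂) := by
  have hl : ∀ x s t, x ∈ bag₁ s → x ∈ bag₁ t →
      Chain (T₁.sum T₂ ⊔ SimpleGraph.edge (.inl r₁) (.inr r₂)) (Sum.elim bag₁ bag₂) x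
        (.inl s) (.inl t) := by
    intro x s t hs ht
    exact (h₁.chain x s t hs ht).lift Sum.inl (fun a b h => ⟨.inl (by simpa using h.1), h.2⟩)
  have hr' : ∀ x s t, x ∈ bag₂ s → x ∈ bag₂ t →
      Chain (T₁.sum T₂ ⊔ SimpleGraph.edge (.inl r₁) (.inr r₂)) (Sum.elim bag₁ bag₂) x
        (.inr s) (.inr t) := by
    intro x s t hs ht
    exact (h₂.chain x s t hs ht).lift Sum.inr (fun a b h => ⟨.inl (by simpa using h.1), h.2⟩)
  have hlr : ∀ x s t, x ∈ bag₁ s → x ∈ bag₂ t →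
      Chain (T₁.sum T₂ ⊔ SimpleGraph.edge (.inl r₁) (.inr r₂)) (Sum.elim bag₁ bag₂) x
        (.inl s) (.inr t) := by
    intro x s t hs ht
    have hx := hr x (h₁.bag_subset s hs) (h₂.bag_subset t ht)
    refine (Relation.ReflTransGen.tail (hl x s r₁ hs hx.1) ?_).trans (hr' x r₂ t hx.2 ht)
    exact ⟨.inr (by simp [SimpleGraph.edge_adj]), hx⟩
  refine ⟨⟨h₁.isTree.1.sum_sup_edge h₂.isTree.1,
    (isAcyclic_sum h₁.isTree.2 h₂.isTree.2).sup_edge_of_not_reachable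
      (SimpleGraph.not_reachable_sum_inl_inr _ _)⟩, ?_, ?_, ?_, ?_⟩
  · rintro (t | t)
    · exact (h₁.bag_subset t).trans subset_union_left
    · exact (h₂.bag_subset t).trans subset_union_right
  · intro x hx
    rcases mem_union.1 hx with h | h
    · obtain ⟨t, ht⟩ := h₁.exists_mem x h
      exact ⟨.inl t, ht⟩
    · obtain ⟨t, ht⟩ := h₂.exists_mem x h
      exact ⟨.inr t, ht⟩
  · intro x hx y hy hxy
    have : (x ∈ S₁ ∧ y ∈ S₁) ∨ (x ∈ S₂ ∧ y ∈ S₂) := by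
      have g2 := fun a b c d => hn y a b x c d hxy.symm
      rw [mem_union] at hx hy
      by_contra hc
      push Not at hc
      have g3 := fun a b c d => hn x a b y c d hxy
      tauto
    rcases this with h | h
    · obtain ⟨t, ht⟩ := h₁.exists_edge x h.1 y h.2 hxy
      exact ⟨.inl t, ht⟩
    · obtain ⟨t, ht⟩ := h₂.exists_edge x h.1 y h.2 hxy
      exact ⟨.inr t, ht⟩
  · rintro x (s | s) (t | t) hs ht
    · exact hl x s t hs ht
    · exact hlr x s t hs ht
    · exact (hlr x t s ht hs).symm
    · exact hr' x s t hs ht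

lemma IsTreeDec.single (S : Finset α) :
    IsTreeDec H S (⊥ : SimpleGraph Unit) (fun _ => S) where
  isTree := .of_subsingleton
  bag_subset _ := subset_rfl
  exists_mem _ hx := ⟨(), hx⟩
  exists_edge _ hx _ hy _ := ⟨(), hx, hy⟩
  chain _ _ _ _ _ := .refl

/-- Turning the inductive decomposition into one over an honest tree forgets the root, which is what
makes re-rooting possible. Each constructor is an instance of `IsTreeDec.join`. -/
lemma Dec.exists_isTreeDec (h : Dec H b X C) :
    ∃ (ι : Type) (_ : Finite ι) (T : SimpleGraph ι) (bag : ι → Finset α) (r : ι),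
      IsTreeDec H (X ∪ C) T bag ∧ bag r = X ∧ ∀ t, #(bag t) ≤ b := by
  induction h with
  | nil X hX =>
    exact ⟨Unit, inferInstance, ⊥, fun _ => X, (), by simpa using IsTreeDec.single X, rfl,
      fun _ => hX⟩
  | union X C₁ C₂ h₁ h₂ hd hn ih₁ ih₂ =>
    obtain ⟨ι₁, _, T₁, bag₁, r₁, k₁, e₁, l₁⟩ := ih₁
    obtain ⟨ι₂, _, T₂, bag₂, r₂, k₂, e₂, l₂⟩ := ih₂
    refine ⟨ι₁ ⊕ ι₂, inferInstance, T₁.sum T₂ ⊔ SimpleGraph.edge (.inl r₁) (.inr r₂),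
      Sum.elim bag₁ bag₂, .inl r₁, ?_, e₁, ?_⟩
    · have := k₁.join k₂ r₁ r₂ (fun x hx hx2 => by
        have : x ∈ C₁ → x ∉ C₂ := fun h => disjoint_left.1 hd h
        rw [mem_union] at hx hx2
        rw [e₁, e₂]; tauto) (fun x hx hx2 y hy hy2 => by
        rw [mem_union] at hx hx2 hy hy2
        exact hn x (by tauto) y (by tauto))
      rwa [show X ∪ (C₁ ∪ C₂) = (X ∪ C₁) ∪ (X ∪ C₂) by rw [union_union_distrib_left]]
    · rintro (t | t)
      · exact l₁ t
      · exact l₂ t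
  | step X X' C hX h hd hn ih =>
    obtain ⟨ι, _, T, bag, r, k, e, l⟩ := ih
    refine ⟨Unit ⊕ ι, inferInstance,
      (⊥ : SimpleGraph Unit).sum T ⊔ SimpleGraph.edge (.inl ()) (.inr r), Sum.elim (fun _ => X) bag, .inl (), ?_, rfl, ?_⟩
    · have := (IsTreeDec.single (H := H) X).join k () r (fun x hx hx2 => by
        have := disjoint_left.1 hd hx
        rw [mem_union] at hx2
        rw [e]; tauto) (fun x hx hx2 y hy hy2 hxy => by
        rw [mem_union] at hx2 hy
        refine hn y ?_ x ?_ hxy.symm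
        · simp only [mem_union, mem_sdiff]; tauto
        · simp only [mem_sdiff]; tauto)
      rwa [show X ∪ (X' \ X ∪ C) = X ∪ (X' ∪ C) by
        ext x; simp only [mem_union, mem_sdiff]; tauto]
    · rintro (t | t)
      · exact hX
      · exact l t

/-- A rooted decomposition can be re-rooted at any vertex. -/
lemma Small.dec_singleton (h : Small H b S) (hb : 1 ≤ b) {x : α} (hx : x ∈ S) :
    Dec H b {x} (S.erase x) := by
  obtain ⟨ι, _, T, bag, r, k, -, l⟩ := Dec.exists_isTreeDec h
  rw [empty_union] at k
  obtain ⟨t, ht⟩ := k.exists_mem x hx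
  have h1 := k.dec l t
  have h2 := Dec.step {x} (bag t) _ (by simpa using hb) h1
    (by simp [ht]) (fun y _ z hz => by
      rw [mem_sdiff, mem_singleton] at hz
      exact absurd (hz.1 ▸ ht) hz.2)
  have e : bag t \ {x} ∪ S \ bag t = S.erase x := by
    ext y
    have : y ∈ bag t → y ∈ S := fun h => k.bag_subset t h
    simp only [mem_union, mem_sdiff, mem_singleton, mem_erase]
    by_cases hy : y = x
    · subst hy; simp [ht]
    · tauto
  rwa [e] at h2

end TreewidthSplit

/-! ### Transfer between multigraphs and their underlying simple graphs -/

namespace TreewidthSplit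

open Finset
open scoped Classical

variable {α : Type u} {β : Type v} {H : SimpleGraph α} {b t : ℕ} {S V : Finset α}

lemma Chain.reachable_induce {ι : Type*} {T : SimpleGraph ι} {bag : ι → Finset α} {x : α}
    {s t : ι} (h : Chain T bag x s t) (hs : x ∈ bag s) :
    ∃ ht : x ∈ bag t, (T.induce {t | x ∈ bag t}).Reachable ⟨s, hs⟩ ⟨t, ht⟩ := by
  induction h with
  | refl => exact ⟨hs, .refl _⟩
  | @tail u v _ h ih =>
    obtain ⟨hu, hr⟩ := ih
    refine ⟨h.2.2, hr.trans (SimpleGraph.Adj.reachable ?_)⟩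
    simpa using h.1

/-- A decomposition into bags of size at most `b` yields a tree decomposition of the multigraph. -/
lemma Small.exists_treeDecomposition (h : Small H b S) (G : Graph α β) (hS : G.vertexSet = ↑S)
    (hH : ∀ e x y, G.IsLink e x y → x ≠ y → H.Adj x y) :
    ∃ (n : ℕ) (D : G.TreeDecomposition (Fin n)), ∀ t, #(D.bag t) ≤ b := by
  obtain ⟨ι, _, T, bag, -, k, -, l⟩ := Dec.exists_isTreeDec h
  rw [empty_union] at k
  obtain ⟨n, ⟨φ⟩⟩ := Finite.exists_equiv_fin ι
  have hchain : ∀ x s t, x ∈ bag (φ.symm s) → x ∈ bag (φ.symm t) →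
      Chain (T.comap φ.symm) (bag ∘ φ.symm) x s t := by
    intro x s t hs ht
    have := (k.chain x _ _ hs ht).lift (r := fun s t => T.Adj s t ∧ x ∈ bag s ∧ x ∈ bag t)
      (p := fun s t => (T.comap φ.symm).Adj s t ∧ x ∈ (bag ∘ φ.symm) s ∧ x ∈ (bag ∘ φ.symm) t)
      φ (fun a b h => by simpa [Function.onFun] using h)
    simpa [Chain, Function.onFun] using this
  refine ⟨n, ⟨T.comap φ.symm, (SimpleGraph.Iso.comap φ.symm T).isTree_iff.2 k.isTree,
    bag ∘ φ.symm, ?_, ?_, ?_, ?_⟩, fun t => l _⟩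
  · intro t
    rw [hS]
    exact_mod_cast k.bag_subset _
  · intro x hx
    rw [hS] at hx
    obtain ⟨t, ht⟩ := k.exists_mem x hx
    exact ⟨φ t, by simpa using ht⟩
  · intro e x y hxy
    have hx : x ∈ S := by have := hxy.left_mem; rwa [hS] at this
    have hy : y ∈ S := by have := hxy.right_mem; rwa [hS] at this
    by_cases hne : x = y
    · subst hne
      obtain ⟨t, ht⟩ := k.exists_mem x hx
      exact ⟨φ t, by simpa using ht⟩
    · obtain ⟨t, ht⟩ := k.exists_edge x hx y hy (hH e x y hxy hne)
      exact ⟨φ t, by simpa using ht⟩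
  · intro x hx
    rw [hS] at hx
    obtain ⟨t, ht⟩ := k.exists_mem x hx
    have : Nonempty {t | x ∈ (bag ∘ φ.symm) t} := ⟨⟨φ t, by simpa using ht⟩⟩
    refine ⟨fun ⟨s, hs⟩ ⟨t, ht⟩ => ?_⟩
    exact ((hchain x s t hs ht).reachable_induce hs).2

lemma Small.treewidth_le (h : Small H b S) (G : Graph α β) (hS : G.vertexSet = ↑S)
    (hH : ∀ e x y, G.IsLink e x y → x ≠ y → H.Adj x y) : G.treewidth ≤ b - 1 := by
  obtain ⟨n, D, hD⟩ := h.exists_treeDecomposition G hS hH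
  have h1 : G.treewidth ≤ D.width := Nat.sInf_le ⟨n, D, rfl⟩
  refine h1.trans ?_
  exact Nat.sub_le_sub_right (Finset.sup_le fun t _ => hD t) 1

lemma le_treewidth (h : ¬ Small H t S) (G : Graph α β) (hS : G.vertexSet = ↑S)
    (hH : ∀ x y, G.Adj x y ∧ x ≠ y ↔ H.Adj x y ∧ x ∈ S ∧ y ∈ S) : t ≤ G.treewidth := by
  by_contra! hlt
  -- Nonemptiness matters, because `sInf ∅ = 0`; one bag containing everything suffices.
  have hne : {k | ∃ (n : ℕ) (D : G.TreeDecomposition (Fin n)), D.width = k}.Nonempty := by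
    obtain ⟨n, D, -⟩ := (Small.of_card_le (H := H) le_rfl).exists_treeDecomposition G hS
      (fun e x y h h' => ((hH x y).1 ⟨h.adj, h'⟩).1)
    exact ⟨_, n, D, rfl⟩
  obtain ⟨n, D, hD⟩ := Nat.sInf_mem hne
  have hw : D.width < t := hD.trans_lt hlt
  -- Width below `t` means bags of size at most `t`, also when the subtraction truncates.
  have hb : ∀ s, #(D.bag s) ≤ t := by
    intro s
    have h1 : #(D.bag s) ≤ Finset.univ.sup fun t => #(D.bag t) :=
      le_sup (f := fun t => #(D.bag t)) (mem_univ s)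
    rw [Graph.TreeDecomposition.width] at hw
    omega
  have k : IsTreeDec H S D.tree D.bag := by
    refine ⟨D.isTree, fun s x hx => ?_, fun x hx => D.vertex_mem x (by rw [hS]; exact hx),
      fun x hx y hy hxy => ?_, fun x s t hs ht => ?_⟩
    · have := D.bag_subset s hx
      rwa [hS] at this
    · obtain ⟨⟨e, he⟩, -⟩ := (hH x y).2 ⟨hxy, hx, hy⟩
      exact D.edge_mem e x y he
    · have hr := (D.connected x (D.bag_subset s hs)).preconnected ⟨s, hs⟩ ⟨t, ht⟩
      rw [SimpleGraph.reachable_iff_reflTransGen] at hr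
      exact hr.lift Subtype.val fun a b hab => ⟨by simpa using hab, a.2, b.2⟩
  obtain ⟨r⟩ := D.isTree.1.nonempty
  have h1 := k.dec hb r
  have h2 := Dec.step ∅ (D.bag r) _ (by simp) h1 (by simp) (by simp)
  refine h (Small.subset h2 fun x hx => ?_)
  simp only [mem_union, mem_sdiff, notMem_empty]
  tauto

/-- The simple graph underlying a multigraph, on the whole vertex type. -/
def underlying (G : Graph α β) : SimpleGraph α where
  Adj x y := x ≠ y ∧ G.Adj x y
  symm := ⟨fun _ _ h => ⟨h.1.symm, h.2.symm⟩⟩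
  loopless := ⟨fun _ h => h.1 rfl⟩

lemma induce_adj {G : Graph α β} {A : Set α} {x y : α} :
    (G.induce A).Adj x y ↔ G.Adj x y ∧ x ∈ A ∧ y ∈ A := by
  simp [Graph.Adj]

lemma induce_isConnected_iff (G : Graph α β) (S : Finset α) :
    (G.induce (S : Set α)).IsConnected ↔ Conn (underlying G) S := by
  have hadj : ∀ a b : (G.induce (S : Set α)).vertexSet,
      (G.induce (S : Set α)).toSimpleGraph.Adj a b ↔ (underlying G).Adj a b := by
    rintro ⟨a, ha⟩ ⟨b, hb⟩
    have ha' : a ∈ S := ha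
    have hb' : b ∈ S := hb
    simp [underlying, Graph.toSimpleGraph, induce_adj, ha', hb']
  constructor
  · intro h
    obtain ⟨⟨x₀, hx₀⟩⟩ := h.nonempty
    refine ⟨⟨x₀, hx₀⟩, fun U hU ⟨x, hx⟩ hcl => subset_antisymm hU fun y hy => ?_⟩
    have hr := h.preconnected ⟨x, hU hx⟩ ⟨y, hy⟩
    rw [SimpleGraph.reachable_iff_reflTransGen] at hr
    have key : ∀ z, Relation.ReflTransGen (G.induce (S : Set α)).toSimpleGraph.Adj ⟨x, hU hx⟩ z →
        (z : α) ∈ U := by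
      intro z hz
      induction hz with
      | refl => exact hx
      | tail _ h ih => exact hcl _ ih _ (Subtype.prop _) ((hadj _ _).1 h)
    exact key _ hr
  · intro h
    obtain ⟨x₀, hx₀⟩ := h.1
    have : Nonempty (G.induce (S : Set α)).vertexSet := ⟨⟨x₀, hx₀⟩⟩
    refine ⟨fun x y => ?_⟩
    have := h.2 {z ∈ S | ∃ hz, (G.induce (S : Set α)).toSimpleGraph.Reachable x ⟨z, hz⟩}
      (filter_subset _ _) ⟨x, mem_filter.2 ⟨x.2, x.2, .refl _⟩⟩ (fun a ha b hb hab => by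
        obtain ⟨-, ha, hr⟩ := mem_filter.1 ha
        refine mem_filter.2 ⟨hb, hb, hr.trans (SimpleGraph.Adj.reachable ?_)⟩
        exact (hadj _ _).2 hab)
    exact (mem_filter.1 (this.symm.subset (show (y : α) ∈ S from y.2))).2.2

lemma induce_isTwoConnected_iff (G : Graph α β) (S : Finset α) :
    (G.induce (S : Set α)).IsTwoConnected ↔ TwoConn (underlying G) S := by
  have hdel : ∀ x, ((G.induce (S : Set α)).deleteVerts {x}).IsConnected ↔
      Conn (underlying G) (S.erase x) := by
    intro x
    rw [← induce_isConnected_iff]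
    have : (G.induce (S : Set α)).deleteVerts {x} = G.induce ((S.erase x : Finset α) : Set α) := by
      refine Graph.ext ?_ fun e a b => ?_
      · ext a; simp [and_comm]
      · simp only [Graph.deleteVerts_isLink, Graph.induce_isLink]
        simp
        tauto
    rw [this]
  constructor
  · intro h
    refine ⟨(induce_isConnected_iff G S).1 h.connected, ?_, fun x hx => (hdel x).1
      (h.no_separator x hx)⟩
    exact one_lt_card_iff_nontrivial.2 h.two_vertices
  · intro h
    exact ⟨(induce_isConnected_iff G S).2 h.1, one_lt_card_iff_nontrivial.1 h.2.1,
      fun x hx => (hdel x).2 (h.2.2 x hx)⟩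

/-- Choosing one edge to each neighbour is injective into the edges at `x`; parallel edges only
raise the degree. -/
lemma card_neighbors_le_maxDeg (G : Graph α β) (hV : G.vertexSet.Finite) (hE : G.edgeSet.Finite)
    {x : α} (hx : x ∈ G.vertexSet) (V : Finset α) :
    #{y ∈ V | (underlying G).Adj x y} ≤ G.maxDeg := by
  have h1 : G.deg x ≤ G.maxDeg := le_csSup (hV.image _).bddAbove ⟨x, hx, rfl⟩
  refine le_trans ?_ h1
  have hadj : ∀ y, (underlying G).Adj x y → ∃ e, G.IsLink e x y := fun y h => h.2
  rcases eq_empty_or_nonempty {y ∈ V | (underlying G).Adj x y} with h0 | ⟨y₀, hy₀⟩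
  · simp [h0]
  have : Nonempty β := (hadj y₀ (mem_filter.1 hy₀).2).nonempty
  choose! f hf using hadj
  rw [Graph.deg, ← Set.ncard_coe_finset]
  refine Set.ncard_le_ncard_of_injOn f ?_ ?_ (hE.subset (G.incidenceSet_subset_edgeSet x))
  · intro y hy
    exact (hf y (mem_filter.1 hy).2).inc_left
  · intro y hy z hz hyz
    have h2 := hf y (mem_filter.1 hy).2
    rw [hyz] at h2
    exact h2.right_unique (hf z (mem_filter.1 hz).2)

/-- A 2-connected set with at least three vertices contains a vertex and a disjoint edge. -/
lemma TwoConn.exists_singleton_pair (hV : TwoConn H V) (h3 : 3 ≤ #V) :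
    ∃ A ⊆ V, ∃ B ⊆ V, Disjoint A B ∧ Conn H A ∧ TwoConn H B := by
  obtain ⟨v, hv⟩ := hV.1.1
  have hc := hV.2.2 v hv
  obtain ⟨x, hx⟩ := hc.1
  obtain ⟨y, hy, hxy⟩ : ∃ y ∈ V.erase v, H.Adj x y := by
    by_contra! hno
    have := hc.2 {x} (singleton_subset_iff.2 hx) (singleton_nonempty x) (fun z hz y hy hzy => by
      rw [mem_singleton.1 hz] at hzy
      exact absurd hzy (hno y hy))
    have h2 := congrArg card this
    rw [card_singleton, card_erase_of_mem hv] at h2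
    omega
  rw [mem_erase] at hx hy
  refine ⟨{v}, singleton_subset_iff.2 hv, {x} ∪ {y}, ?_, ?_, Conn.singleton v, ?_, ?_, ?_⟩
  · simp [insert_subset_iff, hx.2, hy.2]
  · simp [hx.1.symm, hy.1.symm]
  · exact (Conn.singleton x).union (Conn.singleton y) (mem_singleton_self x) (mem_singleton_self y)
      hxy
  · rw [card_union_of_disjoint (by simpa using hxy.ne)]; simp
  · intro z hz
    rw [mem_union, mem_singleton, mem_singleton] at hz
    have hne := hxy.ne
    rcases hz with rfl | rfl
    · have : ({z} ∪ {y} : Finset α).erase z = {y} := by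
        ext a; simp only [mem_erase, mem_union, mem_singleton]; grind
      rw [this]; exact Conn.singleton y
    · have : ({x} ∪ {z} : Finset α).erase z = {x} := by
        ext a; simp only [mem_erase, mem_union, mem_singleton]; grind
      rw [this]; exact Conn.singleton x

end TreewidthSplit

/-! ### The theorem for multigraphs -/

open TreewidthSplit in
theorem lemma4 :
    ∃ c : ℝ, 0 < c ∧
      ∀ (α : Type u) (β : Type v) (G : Graph α β),
        G.vertexSet.Finite → G.edgeSet.Finite → G.Loopless →
        3 ≤ G.vertexSet.ncard → G.IsTwoConnected →
        ∃ A B : Set α, A ∪ B = G.vertexSet ∧ Disjoint A B ∧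
          (G.induce A).IsConnected ∧ (G.induce B).IsTwoConnected ∧
          ⌊c * (G.treewidth : ℝ) / (G.maxDeg : ℝ) ^ 2⌋₊ ≤
            min (G.induce A).treewidth (G.induce B).treewidth := by
  classical
  -- Half the reciprocal of the constant in `small_of_forall_disjoint`.
  refine ⟨1 / 4000000, by norm_num, fun α β G hVfin hEfin _ h3 h2c => ?_⟩
  obtain ⟨V, hV⟩ : ∃ V : Finset α, (V : Set α) = G.vertexSet := ⟨hVfin.toFinset, by simp⟩
  have hV2 : TwoConn (underlying G) V := by
    rw [← induce_isTwoConnected_iff, hV, Graph.induce_vertexSet]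
    exact h2c
  rw [← hV, Set.ncard_coe_finset] at h3
  set t := ⌊1 / 4000000 * (G.treewidth : ℝ) / (G.maxDeg : ℝ) ^ 2⌋₊ with ht
  obtain ⟨A₀, hA₀, B₀, hB₀, hd, hA, hB, hlarge⟩ : ∃ A ⊆ V, ∃ B ⊆ V, Disjoint A B ∧
      Conn (underlying G) A ∧ TwoConn (underlying G) B ∧
      (t = 0 ∨ (¬ Small (underlying G) t A ∧ ¬ Small (underlying G) t B)) := by
    rcases Nat.eq_zero_or_pos t with h0 | hpos
    -- The treewidth bound is void for `t = 0`, so any connected and 2-connected disjoint pair can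
    -- serve as the seed.
    · obtain ⟨A, hA, B, hB, hd, hAc, hBc⟩ := hV2.exists_singleton_pair h3
      exact ⟨A, hA, B, hB, hd, hAc, hBc, .inl h0⟩
    -- Division by zero is zero, so maximum degree `0` would give `t = 0`.
    have hΔ : 1 ≤ G.maxDeg := by
      by_contra hc
      have h0 : G.maxDeg = 0 := by omega
      rw [h0] at ht
      simp at ht
      omega
    by_cases hsep : ∀ A ⊆ V, ∀ B ⊆ V, Disjoint A B →
        Small (underlying G) t A ∨ Small (underlying G) t B
    · exfalso
      have hsmall := small_of_forall_disjoint hΔ hpos (fun x hx =>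
        card_neighbors_le_maxDeg G hVfin hEfin (hV ▸ hx : x ∈ G.vertexSet) V) hsep
      have htw := hsmall.treewidth_le G hV.symm (fun e x y h hne => ⟨hne, h.adj⟩)
      have hpos' : 0 < 2000000 * G.maxDeg * t := by positivity
      have h1 : (t : ℝ) ≤ 1 / 4000000 * (G.treewidth : ℝ) / (G.maxDeg : ℝ) ^ 2 :=
        Nat.floor_le (by positivity)
      have hΔ' : (1 : ℝ) ≤ G.maxDeg := by exact_mod_cast hΔ
      rw [le_div_iff₀ (by positivity)] at h1
      have h2 : (G.treewidth : ℝ) + 1 ≤ 2000000 * G.maxDeg * t := by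
        have : G.treewidth + 1 ≤ 2000000 * G.maxDeg * t := by omega
        exact_mod_cast this
      have ht0 : (0 : ℝ) ≤ t := by positivity
      -- The linear dependence on the degree is weakened to the square here.
      have h4 : (t : ℝ) * G.maxDeg ≤ t * (G.maxDeg : ℝ) ^ 2 :=
        mul_le_mul_of_nonneg_left (by nlinarith) ht0
      nlinarith
    · push Not at hsep
      obtain ⟨A, hA, B, hB, hd, hAn, hBn⟩ := hsep
      obtain ⟨A₁, hA₁, hA₁n, hA₁m⟩ := exists_minimal_not_small hAn
      obtain ⟨B₁, hB₁, hB₁n, hB₁m⟩ := exists_minimal_not_small hBn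
      exact ⟨A₁, hA₁.trans hA, B₁, hB₁.trans hB, hd.mono hA₁ hB₁,
        conn_of_minimal_not_small hA₁n hA₁m,
        twoConn_of_minimal_not_small hpos (fun S x hx h => h.dec_singleton hpos hx) hB₁n hB₁m,
        .inr ⟨hA₁n, hB₁n⟩⟩
  obtain ⟨A, B, hAA, hBB, hAB, hd', hAc, hBc⟩ := hV2.exists_partition hA hB hA₀ hB₀ hd
  refine ⟨A, B, ?_, by exact_mod_cast hd', (induce_isConnected_iff G A).2 hAc,
    (induce_isTwoConnected_iff G B).2 hBc, ?_⟩
  · rw [← hV, ← hAB]; simp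
  · rcases hlarge with h0 | ⟨hAn, hBn⟩
    · rw [h0]; exact Nat.zero_le _
    · have aux : ∀ S : Finset α, ¬ Small (underlying G) t S →
          t ≤ (G.induce (S : Set α)).treewidth :=
        fun S hS => le_treewidth hS _ rfl fun x y => by
          rw [induce_adj]
          simp only [underlying, Finset.mem_coe]
          tauto
      exact le_min (aux A fun h => hAn (h.subset hAA)) (aux B fun h => hBn (h.subset hBB))
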